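/- Let $d\in\{2,3\}$, let $\Omega\subset\mathbb R^d$ be a bounded domain (open and connected) and $t_0<t_1$. Let $\kappa\in L^\infty(\Omega)$ with $\kappa\ge\kappa_{\min}>0$ a.e., $\alpha\in L^\infty(\Omega)$, $Re>0$, sources $g_T\in L^2(t_0,t_1;L^2(\Omega))$ and $g_u\in L^2(\Omega)^d$, and boundary data given by extensions $T_b\in L^2(t_0,t_1;H^1(\Omega))$ with weak time derivative in $L^2(t_0,t_1;L^2(\Omega))$, and $u_b\in H^1(\Omega)^d\cap L^4(\Omega)^d$. For an initial temperature $\pi\in H^1(\Omega)$, the CFD model for $(T_e,u,p)\in L^2(t_0,t_1;H^1(\Omega))\times H^1(\Omega)^d\times L^2(\Omega)$ is, in the weak sense, $$\frac{\partial T_e}{\partial t}-\nabla\cdot(\kappa\nabla T_e)+u\cdot\nabla T_e=g_T\ \text{ in }\Omega\times(t_0,t_1),\qquad T_e=T_b\ \text{ on }\partial\Omega,\qquad T_e(\cdot,t_0)=\pi,$$ $$-\frac1{Re}\Delta u+u\cdot\nabla u+\nabla p+\alpha u=g_u,\qquad \nabla\cdot u=0\ \text{ in }\Omega,\qquad u=u_b\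 \text{ on }\partial\Omega,\qquad \int_\Omega p=0 .$$ Boundary conditions are understood as $T_e(t)-T_b(t)\in H^1_0(\Omega)$ for a.e. $t$, and $u-u_b\in H^1_0(\Omega)^d$. The temperature equation with its initial condition means that, for all $\varphi\in C_c^\infty(\Omega)$ and $\psi\in C_c^\infty((-\infty,t_1))$, $$-\int_{t_0}^{t_1}\psi'\langle T_e,\varphi\rangle\,dt+\int_{t_0}^{t_1}\psi\,\bigl(\langle\kappa\nabla T_e,\nabla\varphi\rangle+\langle u\cdot\nabla T_e,\varphi\rangle\bigr)\,dt=\int_{t_0}^{t_1}\psi\langle g_T,\varphi\rangle\,dt+\psi(t_0)\langle\pi,\varphi\rangle .$$ Let $(u,p)$ be a weak solution of the flow equations (the second line). Then there is a map $S:H^1(\Omega)\to L^2(t_0,t_1;H^1(\Omega))\times H^1(\Omega)^d\times L^2(\Omega)$ such that: 1. for every $\pi\in H^1(\Omega)$, $S(\pi)$ is the unique solution of the CFD model with initial temperature $\pi$ and velocity $u$; if $u$ is the only velocity solving the flow equations, then $S(\pi)$ is the unique solution of the CFD model with initial temperature $\pi$; 2. for every $\pi_0\in H^1(\Omega)$ and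 every direction $\delta\pi_0\in H^1(\Omega)$, the Gateaux derivative $$\lim_{s\to0}\frac{S(\pi_0+s\,\delta\pi_0)-S(\pi_0)}{s}$$ exists in the norm of $L^2(t_0,t_1;H^1(\Omega))\times H^1(\Omega)^d\times L^2(\Omega)$ and equals $(w_t,0,0)$: the derivatives of velocity and pressure are zero, and $w_t\in L^2(t_0,t_1;H^1(\Omega))$ is the unique weak solution of $$\frac{\partial w_t}{\partial t}-\nabla\cdot(\kappa\nabla w_t)+u\cdot\nabla w_t=0\ \text{ in }\Omega\times(t_0,t_1),\qquad w_t=0\ \text{ on }\partial\Omega,\qquad w_t(\cdot,t_0)=\delta\pi_0,$$ where $u$ is the velocity component of $S(\pi_0)$. -/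

import Mathlib

open MeasureTheory Set Filter
open scoped ContDiff ENNReal

noncomputable section

namespace CFD

/-- Points of `d`-dimensional Euclidean space. -/
abbrev Pt (d : ℕ) : Type := EuclideanSpace ℝ (Fin d)

/-- Lebesgue measure on `Ω`. -/
abbrev vol {d : ℕ} (Ω : Set (Pt d)) : Measure (Pt d) := volume.restrict Ω

/-- Lebesgue measure on the time interval `(t₀, t₁)`. -/
abbrev tvol (t₀ t₁ : ℝ) : Measure ℝ := volume.restrict (Ioo t₀ t₁)

/-- `C_c^∞(Ω)`: smooth real functions with compact support contained in `Ω`. -/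
def IsTest {V : Type*} [NormedAddCommGroup V] [NormedSpace ℝ V] (Ω : Set V) (φ : V → ℝ) : Prop :=
  ContDiff ℝ ∞ φ ∧ HasCompactSupport φ ∧ tsupport φ ⊆ Ω

/-- The classical partial derivative `∂φ/∂x_i`. -/
def pd {d : ℕ} (i : Fin d) (φ : Pt d → ℝ) (x : Pt d) : ℝ :=
  fderiv ℝ φ x (EuclideanSpace.single i 1)

lemma IsTest.memLp {d : ℕ} {Ω : Set (Pt d)} {φ : Pt d → ℝ} (h : IsTest Ω φ) :
    MemLp φ 2 (vol Ω) :=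
  h.1.continuous.memLp_of_hasCompactSupport h.2.1

lemma IsTest.memLp_pd {d : ℕ} {Ω : Set (Pt d)} {φ : Pt d → ℝ} (h : IsTest Ω φ) (i : Fin d) :
    MemLp (pd i φ) 2 (vol Ω) :=
  Continuous.memLp_of_hasCompactSupport
    ((h.1.continuous_fderiv (by simp)).clm_apply continuous_const)
    (h.2.1.fderiv_apply (𝕜 := ℝ) _)

lemma IsTest.add {d : ℕ} {Ω : Set (Pt d)} {φ ψ : Pt d → ℝ} (h : IsTest Ω φ) (k : IsTest Ω ψ) :
    IsTest Ω (fun x => φ x + ψ x) :=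
  ⟨h.1.add k.1, h.2.1.add k.2.1, (tsupport_add φ ψ).trans (union_subset h.2.2 k.2.2)⟩

lemma IsTest.smul {d : ℕ} {Ω : Set (Pt d)} {φ : Pt d → ℝ} (c : ℝ) (h : IsTest Ω φ) :
    IsTest Ω (fun x => c * φ x) :=
  ⟨contDiff_const.mul h.1, h.2.1.mul_left,
    (closure_mono (Function.support_mul_subset_right _ _)).trans h.2.2⟩

lemma IsTest.zero {d : ℕ} {Ω : Set (Pt d)} : IsTest Ω (fun _ => (0 : ℝ)) :=
  ⟨contDiff_const, HasCompactSupport.zero, by simp [tsupport]⟩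

/-- `g` is the weak gradient in `Ω` of `v`:
`∫_Ω v ∂_i φ = - ∫_Ω g_i φ` for all `φ ∈ C_c^∞(Ω)` and all `i`. -/
def IsWeakGrad {d : ℕ} (Ω : Set (Pt d)) (v : Lp ℝ 2 (vol Ω)) (g : Lp (Pt d) 2 (vol Ω)) : Prop :=
  ∀ (i : Fin d) (φ : Pt d → ℝ), IsTest Ω φ →
    ∫ x in Ω, v x * pd i φ x = - ∫ x in Ω, g x i * φ x

lemma memLp_coord {d : ℕ} {Ω : Set (Pt d)} (g : Lp (Pt d) 2 (vol Ω)) (i : Fin d) :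
    MemLp (fun x => g x i) 2 (vol Ω) :=
  (EuclideanSpace.proj (𝕜 := ℝ) i : Pt d →L[ℝ] ℝ).comp_memLp' (Lp.memLp g)

/-- The Sobolev space `H¹(Ω)`, as the space of pairs `(v, ∇v)` in `L²(Ω) × L²(Ω; ℝ^d)`, with the
norm `(‖v‖² + ‖∇v‖²)^{1/2}`. (The weak gradient of `v` is unique when `Ω` is open.) -/
def H1 {d : ℕ} (Ω : Set (Pt d)) :
    Submodule ℝ (WithLp 2 (Lp ℝ 2 (vol Ω) × Lp (Pt d) 2 (vol Ω))) where
  carrier := {z | IsWeakGrad Ω z.fst z.snd}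
  zero_mem' := by
    intro i φ _
    have h1 : ∫ x in Ω, (0 : Lp ℝ 2 (vol Ω)) x * pd i φ x = 0 := by
      rw [integral_eq_zero_of_ae]
      filter_upwards [Lp.coeFn_zero ℝ 2 (vol Ω)] with x hx
      rw [hx]; simp
    have h2 : ∫ x in Ω, (0 : Lp (Pt d) 2 (vol Ω)) x i * φ x = 0 := by
      rw [integral_eq_zero_of_ae]
      filter_upwards [Lp.coeFn_zero (Pt d) 2 (vol Ω)] with x hx
      rw [hx]; simp
    simp only [WithLp.zero_fst, WithLp.zero_snd]
    rw [h1, h2, neg_zero]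
  add_mem' := by
    intro a b ha hb i φ hφ
    have h1 : ∫ x in Ω, (a.fst + b.fst : Lp ℝ 2 (vol Ω)) x * pd i φ x
        = (∫ x in Ω, a.fst x * pd i φ x) + ∫ x in Ω, b.fst x * pd i φ x := by
      refine Eq.trans ?_ (integral_add ((Lp.memLp a.fst).integrable_mul (hφ.memLp_pd i))
        ((Lp.memLp b.fst).integrable_mul (hφ.memLp_pd i)))
      refine integral_congr_ae ?_
      filter_upwards [Lp.coeFn_add a.fst b.fst] with x hx
      rw [hx]; simp [add_mul]
    have h2 : ∫ x in Ω, (a.snd + b.snd : Lp (Pt d) 2 (vol Ω)) x i * φ x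
        = (∫ x in Ω, a.snd x i * φ x) + ∫ x in Ω, b.snd x i * φ x := by
      refine Eq.trans ?_ (integral_add ((memLp_coord a.snd i).integrable_mul hφ.memLp)
        ((memLp_coord b.snd i).integrable_mul hφ.memLp))
      refine integral_congr_ae ?_
      filter_upwards [Lp.coeFn_add a.snd b.snd] with x hx
      rw [hx]; simp [add_mul]
    simp only [WithLp.add_fst, WithLp.add_snd]
    rw [h1, h2, ha i φ hφ, hb i φ hφ]
    ring
  smul_mem' := by
    intro c a ha i φ hφ
    have h1 : ∫ x in Ω, (c • a.fst : Lp ℝ 2 (vol Ω)) x * pd i φ x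
        = c * ∫ x in Ω, a.fst x * pd i φ x := by
      rw [← integral_const_mul]
      refine integral_congr_ae ?_
      filter_upwards [Lp.coeFn_smul c a.fst] with x hx
      rw [hx]; simp [mul_assoc]
    have h2 : ∫ x in Ω, (c • a.snd : Lp (Pt d) 2 (vol Ω)) x i * φ x
        = c * ∫ x in Ω, a.snd x i * φ x := by
      rw [← integral_const_mul]
      refine integral_congr_ae ?_
      filter_upwards [Lp.coeFn_smul c a.snd] with x hx
      rw [hx]; simp [mul_assoc]
    simp only [WithLp.smul_fst, WithLp.smul_snd]
    rw [h1, h2, ha i φ hφ]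
    ring

/-- The underlying `L²` function of an element of `H¹(Ω)`. -/
def val {d : ℕ} {Ω : Set (Pt d)} (v : H1 Ω) : Lp ℝ 2 (vol Ω) := v.1.fst

/-- The weak gradient of an element of `H¹(Ω)`. -/
def grad {d : ℕ} {Ω : Set (Pt d)} (v : H1 Ω) : Lp (Pt d) 2 (vol Ω) := v.1.snd

/-- The subspace of `H¹(Ω)` of the (classes of) functions in `C_c^∞(Ω)`. -/
def testH1 {d : ℕ} (Ω : Set (Pt d)) : Submodule ℝ (H1 Ω) where
  carrier := {v | ∃ φ : Pt d → ℝ, IsTest Ω φ ∧ val v =ᵐ[vol Ω] φ}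
  zero_mem' := ⟨fun _ => 0, IsTest.zero, Lp.coeFn_zero ℝ 2 (vol Ω)⟩
  add_mem' := by
    rintro a b ⟨φ, hφ, ha⟩ ⟨ψ, hψ, hb⟩
    refine ⟨_, hφ.add hψ, ?_⟩
    filter_upwards [Lp.coeFn_add (val a) (val b), ha, hb] with x hx h1 h2
    have : val (a + b) = val a + val b := rfl
    rw [this, hx, Pi.add_apply, h1, h2]
  smul_mem' := by
    rintro c a ⟨φ, hφ, ha⟩
    refine ⟨_, hφ.smul c, ?_⟩
    filter_upwards [Lp.coeFn_smul c (val a), ha] with x hx h1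
    have : val (c • a) = c • val a := rfl
    rw [this, hx, Pi.smul_apply, h1, smul_eq_mul]

/-- `H¹₀(Ω)`, the closure of `C_c^∞(Ω)` in `H¹(Ω)`: the functions with zero boundary values. -/
def H10 {d : ℕ} (Ω : Set (Pt d)) : Submodule ℝ (H1 Ω) := (testH1 Ω).topologicalClosure

/-- Temperature fields: `L²(t₀, t₁; H¹(Ω))`. -/
abbrev Temp {d : ℕ} (Ω : Set (Pt d)) (t₀ t₁ : ℝ) : Type := Lp (H1 Ω) 2 (tvol t₀ t₁)

/-- Velocity fields: `H¹(Ω)^d`. -/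
abbrev Vel {d : ℕ} (Ω : Set (Pt d)) : Type := PiLp 2 (fun _ : Fin d => H1 Ω)

/-- Pressure fields: `L²(Ω)`. -/
abbrev Pres {d : ℕ} (Ω : Set (Pt d)) : Type := Lp ℝ 2 (vol Ω)

/-- States `(T_e, u, p)`, in `L²(t₀, t₁; H¹(Ω)) × H¹(Ω)^d × L²(Ω)`. -/
abbrev State {d : ℕ} (Ω : Set (Pt d)) (t₀ t₁ : ℝ) : Type := Temp Ω t₀ t₁ × Vel Ω × Pres Ω

/-- `(u · ∇v)(x)`. -/
def advect {d : ℕ} {Ω : Set (Pt d)} (u : Vel Ω) (v : H1 Ω) (x : Pt d) : ℝ :=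
  ∑ j, val (u j) x * grad v x j

/-- `G'` is the weak derivative on `(t₀, t₁)` of `t ↦ G t`, as a function with values in `L²(Ω)`:
`∫ ψ'(t) G(t) dt = - ∫ ψ(t) G'(t) dt` for `ψ ∈ C_c^∞((t₀, t₁))`. -/
def IsWeakTimeDeriv {d : ℕ} {Ω : Set (Pt d)} {t₀ t₁ : ℝ} (G : Temp Ω t₀ t₁)
    (G' : Lp (Lp ℝ 2 (vol Ω)) 2 (tvol t₀ t₁)) : Prop :=
  ∀ ψ : ℝ → ℝ, IsTest (Ioo t₀ t₁) ψ →
    ∫ t in Ioo t₀ t₁, deriv ψ t • val (G t) = - ∫ t in Ioo t₀ t₁, ψ t • G' t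

/-- `T` is a weak solution, in `L²(t₀, t₁; H¹(Ω))`, of
`∂T/∂t - ∇ · (κ ∇T) + u · ∇T = g` in `Ω × (t₀, t₁)`, `T = Tb` on `∂Ω × (t₀, t₁)`, `T(t₀) = π`:
for every `φ ∈ C_c^∞(Ω)`, the identity `d/dt ⟨T, φ⟩ + ⟨κ ∇T, ∇φ⟩ + ⟨u · ∇T, φ⟩ = ⟨g, φ⟩` holds in
the sense of distributions on `[t₀, t₁)` with `⟨T(t₀), φ⟩ = ⟨π, φ⟩`. The time test functions `ψ`
vanish near `t₁` but not at `t₀`; the term with `ψ t₀` is the initial condition. -/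
def IsTemperature {d : ℕ} {Ω : Set (Pt d)} {t₀ t₁ : ℝ} (κ : Pt d → ℝ) (u : Vel Ω)
    (g : Lp (Lp ℝ 2 (vol Ω)) 2 (tvol t₀ t₁)) (Tb : Temp Ω t₀ t₁) (π : H1 Ω)
    (T : Temp Ω t₀ t₁) : Prop :=
  (∀ᵐ t ∂(tvol t₀ t₁), T t - Tb t ∈ H10 Ω) ∧
  ∀ (φ : Pt d → ℝ) (ψ : ℝ → ℝ), IsTest Ω φ → IsTest (Iio t₁) ψ →
    - (∫ t in Ioo t₀ t₁, deriv ψ t * ∫ x in Ω, val (T t) x * φ x)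
      + (∫ t in Ioo t₀ t₁, ψ t * ∫ x in Ω, κ x * ∑ j, grad (T t) x j * pd j φ x)
      + (∫ t in Ioo t₀ t₁, ψ t * ∫ x in Ω, advect u (T t) x * φ x)
    = (∫ t in Ioo t₀ t₁, ψ t * ∫ x in Ω, g t x * φ x) + ψ t₀ * ∫ x in Ω, val π x * φ x

/-- The data of the model other than the initial temperature. -/
structure Data {d : ℕ} (Ω : Set (Pt d)) (t₀ t₁ : ℝ) where
  /-- thermal diffusivity -/
  κ : Pt d → ℝ
  /-- friction coefficient -/
  α : Pt d → ℝ
  /-- Reynolds number -/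
  Re : ℝ
  /-- heat source -/
  gT : Lp (Lp ℝ 2 (vol Ω)) 2 (tvol t₀ t₁)
  /-- flow source -/
  gu : Lp (Pt d) 2 (vol Ω)
  /-- boundary temperature, given by an extension to `Ω × (t₀, t₁)` -/
  Tb : Temp Ω t₀ t₁
  /-- boundary velocity, given by an extension to `Ω` -/
  ub : Vel Ω

/-- Admissible data: `κ` is bounded and bounded below by a positive constant, `α` is bounded,
`Re > 0`, the boundary temperature has a weak time derivative in `L²(t₀, t₁; L²(Ω))`, the boundary
velocity is in `L⁴(Ω)`. -/
structure Data.Admissible {d : ℕ} {Ω : Set (Pt d)} {t₀ t₁ : ℝ} (D : Data Ω t₀ t₁) : Prop where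
  κ_bdd : MemLp D.κ ∞ (vol Ω)
  κ_pos : ∃ c : ℝ, 0 < c ∧ ∀ᵐ x ∂(vol Ω), c ≤ D.κ x
  α_bdd : MemLp D.α ∞ (vol Ω)
  Re_pos : 0 < D.Re
  Tb_deriv : ∃ G', IsWeakTimeDeriv D.Tb G'
  ub_L4 : ∀ i, MemLp (val (D.ub i)) 4 (vol Ω)

/-- `(u, p)` is a weak solution of the stationary Navier–Stokes equations
`- (1/Re) Δu + u · ∇u + ∇p + α u = g_u`, `∇ · u = 0` in `Ω`, `u = u_b` on `∂Ω`,
the pressure being normalised by `∫_Ω p = 0`. -/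
def IsFlow {d : ℕ} {Ω : Set (Pt d)} {t₀ t₁ : ℝ} (D : Data Ω t₀ t₁) (u : Vel Ω) (p : Pres Ω) :
    Prop :=
  (∀ i, u i - D.ub i ∈ H10 Ω) ∧
  (∀ᵐ x ∂(vol Ω), ∑ i, grad (u i) x i = 0) ∧
  (∫ x in Ω, p x = 0) ∧
  ∀ (i : Fin d) (φ : Pt d → ℝ), IsTest Ω φ →
    (∫ x in Ω, D.α x * val (u i) x * φ x)
      + (1 / D.Re) * (∫ x in Ω, ∑ j, grad (u i) x j * pd j φ x)
      + (∫ x in Ω, advect u (u i) x * φ x)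
      - (∫ x in Ω, p x * pd i φ x)
    = ∫ x in Ω, D.gu x i * φ x

/-- `z = (T_e, u, p)` is a solution of the CFD model with initial temperature `π`. -/
def IsCFDSolution {d : ℕ} {Ω : Set (Pt d)} {t₀ t₁ : ℝ} (D : Data Ω t₀ t₁) (π : H1 Ω)
    (z : State Ω t₀ t₁) : Prop :=
  IsFlow D z.2.1 z.2.2 ∧ IsTemperature D.κ z.2.1 D.gT D.Tb π z.1

end CFD

end

/-!
Two pressures with the same velocity differ by an `L²` function with zero weak gradient; `Ω` being
connected, this is a constant, and it is zero because both pressures have zero mean. With the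
velocity fixed, the temperature equation is linear, so `S` is affine and its difference quotients
do not depend on `s`: their common value `w` solves the equation with zero source, zero boundary
values and initial temperature `δπ₀`.

The parabolic problem is well posed. Existence follows from Lions' representation lemma, applied to
the backward operator on continuous `H¹₀(Ω)`-valued functions; for uniqueness the equation is
integrated in time and paired with the primitive of the solution. Both arguments need
only that the spatial operator is bounded and coercive. Diffusion is coercive by Poincaré's
inequality. Advection is bounded since `H¹₀(Ω) ⊆ L⁴(Ω)` for `d ≤ 4`, and it does not affect
coercivity, because `2 (u · ∇w) w = u · ∇(w²)` integrates to zero when `∇ · u = 0`.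
-/

namespace CFD

open scoped Topology Convolution RealInnerProductSpace NNReal InnerProduct

section Test

variable {V : Type*} [NormedAddCommGroup V] [NormedSpace ℝ V] {U U' : Set V} {φ : V → ℝ}

lemma IsTest.mono (hφ : IsTest U φ) (h : U ⊆ U') : IsTest U' φ :=
  ⟨hφ.1, hφ.2.1, hφ.2.2.trans h⟩

lemma IsTest.eq_zero_of_notMem (hφ : IsTest U φ) {x : V} (hx : x ∉ U) : φ x = 0 :=
  image_eq_zero_of_notMem_tsupport fun h => hx (hφ.2.2 h)

lemma IsTest.fderiv_apply (hφ : IsTest U φ) (v : V) : IsTest U fun x => fderiv ℝ φ x v :=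
  ⟨(hφ.1.fderiv_right (m := ∞) (by simp)).clm_apply contDiff_const,
    hφ.2.1.fderiv_apply (𝕜 := ℝ) v, (tsupport_fderiv_apply_subset ℝ v).trans hφ.2.2⟩

variable {E : Type*} [NormedAddCommGroup E] [NormedSpace ℝ E] [MeasurableSpace V] {μ : Measure V}

lemma IsTest.setIntegral_smul (hφ : IsTest U φ) (f : V → E) :
    ∫ x in U, φ x • f x ∂μ = ∫ x, φ x • f x ∂μ :=
  setIntegral_eq_integral_of_forall_compl_eq_zero fun x hx => by
    rw [hφ.eq_zero_of_notMem hx, zero_smul]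

end Test

section Topological

variable {X E : Type*} [TopologicalSpace X] [MeasurableSpace X] {μ : Measure X} {U : Set X}
  {f : X → E}

lemma nhds_inf_ae_neBot [μ.IsOpenPosMeasure] (x : X) : (𝓝 x ⊓ ae μ).NeBot := by
  refine inf_neBot_iff.2 fun s hs t ht => ?_
  by_contra hst
  exact (μ.measure_pos_of_mem_nhds hs).ne'
    (measure_mono_null (fun y hy hyt => hst ⟨y, hy, hyt⟩) ht)

lemma exists_ae_eq_const_of_locally [μ.IsOpenPosMeasure] [SecondCountableTopology X]
    (hU : IsPreconnected U) (hne : U.Nonempty)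
    (h : ∀ x ∈ U, ∃ c, ∀ᶠ z in 𝓝 x ⊓ ae μ, f z = c) : ∃ c, ∀ᵐ x ∂μ, x ∈ U → f x = c := by
  let ConstNear (x : X) (c : E) : Prop := ∀ᶠ z in 𝓝 x ⊓ ae μ, f z = c
  have huniq {x : X} {a b : E} (ha : ConstNear x a) (hb : ConstNear x b) : a = b := by
    have := nhds_inf_ae_neBot (μ := μ) x
    obtain ⟨z, hza, hzb⟩ := (ha.and hb).exists
    exact hza.symm.trans hzb
  have hlocal : ∀ x ∈ U, ∀ᶠ y in 𝓝[U] x, ∃ c, ConstNear x c ∧ ConstNear y c := fun x hx => by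
    obtain ⟨c, hc⟩ := h x hx
    obtain ⟨s, hs, t, ht, hst⟩ := mem_inf_iff.1 hc
    filter_upwards [nhdsWithin_le_nhds (eventually_mem_nhds_iff.2 hs)] with y hy
    exact ⟨c, hc, mem_inf_iff.2 ⟨s, hy, t, ht, hst⟩⟩
  obtain ⟨x₀, hx₀⟩ := hne
  obtain ⟨c, hc⟩ := h x₀ hx₀
  have hconst {x : X} (hx : x ∈ U) : ConstNear x c := by
    obtain ⟨c', hc', hcx⟩ := hU.induction₂ (fun x y => ∃ c, ConstNear x c ∧ ConstNear y c) hlocal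
      (fun _ _ _ _ _ _ ⟨a, hx, hy⟩ ⟨b, hy', hz⟩ => ⟨a, hx, huniq hy' hy ▸ hz⟩)
      (fun _ _ _ _ ⟨a, hx, hy⟩ => ⟨a, hy, hx⟩) hx₀ hx
    rwa [huniq hc hc']
  refine ⟨c, ae_iff.2 (measure_null_of_locally_null _ fun x hx => ?_)⟩
  obtain ⟨s, hs, t, ht, hst⟩ := mem_inf_iff.1 (hconst (Classical.not_imp.1 hx).1)
  refine ⟨s ∩ {x | ¬(x ∈ U → f x = c)}, inter_mem (mem_nhdsWithin_of_mem_nhds hs)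
    self_mem_nhdsWithin, measure_mono_null (t := tᶜ) (fun y hy hyt => hy.2 fun _ => ?_) ht⟩
  exact hst.ge ⟨hy.1, hyt⟩

end Topological

section Constancy

variable {V E : Type*} [NormedAddCommGroup V] [NormedSpace ℝ V] [MeasurableSpace V]
  [NormedAddCommGroup E] [NormedSpace ℝ E] {μ : Measure V} {U U' : Set V} {f : V → E}

/-- All weak directional derivatives of `f` vanish in `U`. -/
def HasZeroWeakFDeriv (μ : Measure V) (U : Set V) (f : V → E) : Prop :=
  ∀ φ, IsTest U φ → ∀ v, ∫ x, fderiv ℝ φ x v • f x ∂μ = 0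

lemma HasZeroWeakFDeriv.indicator (hf : HasZeroWeakFDeriv μ U f) :
    HasZeroWeakFDeriv μ U (U.indicator f) := fun φ hφ v => by
  rw [← hf φ hφ v]
  refine integral_congr_ae (.of_forall fun x => ?_)
  by_cases hx : x ∈ U
  · simp only [indicator_of_mem hx]
  · simp only [(hφ.fderiv_apply v).eq_zero_of_notMem hx, zero_smul]

variable [BorelSpace V] [FiniteDimensional ℝ V] [μ.IsAddHaarMeasure]

lemma isTest_bump_sub (b : ContDiffBump (0 : V)) {x : V}
    (hx : Metric.closedBall x b.rOut ⊆ U) : IsTest U fun y => b.normed μ (x - y) := by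
  have hsupp : tsupport (fun y => b.normed μ (x - y)) ⊆ Metric.closedBall x b.rOut := by
    refine closure_minimal (fun y hy => ?_) Metric.isClosed_closedBall
    contrapose! hy
    rw [Metric.mem_closedBall, dist_comm, dist_eq_norm, not_le] at hy
    refine Function.notMem_support.2 (image_eq_zero_of_notMem_tsupport fun h => hy.not_ge ?_)
    rwa [b.tsupport_normed_eq, mem_closedBall_zero_iff] at h
  exact ⟨b.contDiff_normed.comp (contDiff_const.sub contDiff_id),
    (isCompact_closedBall x b.rOut).of_isClosed_subset (isClosed_tsupport _) hsupp,
    hsupp.trans hx⟩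

lemma hasFDerivAt_convolution_zero (hf : LocallyIntegrable f μ) {φ : V → ℝ}
    (hφ : ContDiff ℝ 1 φ) (hφc : HasCompactSupport φ) {x : V}
    (h : ∀ v, ∫ y, fderiv ℝ (fun y => φ (x - y)) y v • f y ∂μ = 0) :
    HasFDerivAt (φ ⋆[ContinuousLinearMap.lsmul ℝ ℝ, μ] f) (0 : V →L[ℝ] E) x := by
  have hex : ConvolutionExists (fderiv ℝ φ) f ((ContinuousLinearMap.lsmul ℝ ℝ).precompL V) μ :=
    (hφc.fderiv (𝕜 := ℝ)).convolutionExists_left _ (hφ.continuous_fderiv (by simp)) hf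
  have hzero : (fderiv ℝ φ ⋆[(ContinuousLinearMap.lsmul ℝ ℝ).precompL V, μ] f) x = 0 := by
    ext v
    rw [convolution_eq_swap, ContinuousLinearMap.integral_apply (hex x).integrable_swap,
      zero_apply, ← neg_zero, ← h v, ← integral_neg]
    refine integral_congr_ae (.of_forall fun y => ?_)
    have hchain : fderiv ℝ (fun y => φ (x - y)) y = -fderiv ℝ φ (x - y) := by
      simpa [Function.comp_def] using ((hφ.differentiable (by simp) (x - y)).hasFDerivAt.comp y
        ((hasFDerivAt_const x y).sub (hasFDerivAt_id y))).fderiv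
    simp [ContinuousLinearMap.precompL_apply, hchain]
  exact hzero ▸ hφc.hasFDerivAt_convolution_left (ContinuousLinearMap.lsmul ℝ ℝ) hφ hf x

/-- Near each point the mollifications of `f` have zero derivative, hence are constant. -/
lemma HasZeroWeakFDeriv.exists_eventually_eq_const [CompleteSpace E]
    (hf : HasZeroWeakFDeriv μ U f) (hU : IsOpen U) (hfi : IntegrableOn f U μ) {x : V}
    (hx : x ∈ U) : ∃ c, ∀ᶠ y in 𝓝 x ⊓ ae μ, f y = c := by
  obtain ⟨R, hR, hball⟩ := Metric.isOpen_iff.1 hU x hx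
  have hg : LocallyIntegrable (U.indicator f) μ :=
    ((integrable_indicator_iff hU.measurableSet).2 hfi).locallyIntegrable
  let b : ℕ → ContDiffBump (0 : V) := fun n =>
    ⟨R / 4 / (n + 1), R / 2 / (n + 1), by positivity, by gcongr; norm_num⟩
  let F : ℕ → V → E := fun n =>
    (b n).normed μ ⋆[ContinuousLinearMap.lsmul ℝ ℝ, μ] U.indicator f
  have hlim : ∀ᵐ y ∂μ, Tendsto (fun n => F n y) atTop (𝓝 (U.indicator f y)) := by
    refine ContDiffBump.ae_convolution_tendsto_right_of_locallyIntegrable (K := 2) ?_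
      (.of_forall fun n => ?_) hg
    · exact (tendsto_const_div_atTop_nhds_zero_nat (R / 2)).comp (tendsto_add_atTop_nat 1)
        |>.congr fun n => by simp [b]
    · exact le_of_eq (by simp only [b]; ring)
  have hF (n : ℕ) : ∀ y ∈ Metric.ball x (R / 2), HasFDerivAt (F n) (0 : V →L[ℝ] E) y := by
    intro y hy
    refine hasFDerivAt_convolution_zero hg (b n).contDiff_normed (b n).hasCompactSupport_normed
      (hf.indicator _ (isTest_bump_sub (b n) ?_))
    have hout : (b n).rOut ≤ R / 2 := div_le_self (by positivity) (by simp)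
    exact (Metric.closedBall_subset_ball' (by rw [Metric.mem_ball] at hy; linarith)).trans hball
  refine ⟨limUnder atTop fun n => F n x, ?_⟩
  have hnear : ∀ᶠ y in 𝓝 x ⊓ ae μ, y ∈ Metric.ball x (R / 2) :=
    mem_inf_of_left (Metric.ball_mem_nhds x (by positivity))
  filter_upwards [hlim.filter_mono inf_le_right, hnear] with y hy hyb
  have hyU : y ∈ U := hball (Metric.ball_subset_ball (by linarith) hyb)
  rw [indicator_of_mem hyU] at hy
  refine (Tendsto.limUnder_eq (hy.congr fun n => ?_)).symm
  exact (convex_ball x (R / 2)).is_const_of_fderivWithin_eq_zero (𝕜 := ℝ)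
    (fun z hz => (hF n z hz).differentiableAt.differentiableWithinAt)
    (fun z hz => (hF n z hz).hasFDerivWithinAt.fderivWithin
      (Metric.isOpen_ball.uniqueDiffWithinAt hz)) hyb (Metric.mem_ball_self (by positivity))

theorem HasZeroWeakFDeriv.exists_ae_eq_const [CompleteSpace E] (hf : HasZeroWeakFDeriv μ U f)
    (hU : IsOpen U) (hUc : IsConnected U) (hfi : IntegrableOn f U μ) :
    ∃ c, f =ᵐ[μ.restrict U] fun _ => c := by
  simp only [EventuallyEq, ae_restrict_iff' hU.measurableSet]
  exact exists_ae_eq_const_of_locally hUc.isPreconnected hUc.nonempty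
    fun x hx => hf.exists_eventually_eq_const hU hfi hx

end Constancy

section Pressure

variable {d : ℕ} {Ω : Set (Pt d)}

lemma fderiv_apply_eq_sum_pd (φ : Pt d → ℝ) (x v : Pt d) :
    fderiv ℝ φ x v = ∑ i, v i * pd i φ x := by
  conv_lhs => rw [← (EuclideanSpace.basisFun (Fin d) ℝ).sum_repr v]
  simp only [map_sum, map_smul, EuclideanSpace.basisFun_repr, EuclideanSpace.basisFun_apply,
    smul_eq_mul, pd]

lemma hasZeroWeakFDeriv_of_integral_mul_pd {f : Pt d → ℝ} (hf : MemLp f 2 (vol Ω))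
    (h : ∀ i φ, IsTest Ω φ → ∫ x in Ω, f x * pd i φ x = 0) :
    HasZeroWeakFDeriv volume Ω f := fun φ hφ v => by
  calc ∫ x, fderiv ℝ φ x v • f x
      = ∫ x in Ω, fderiv ℝ φ x v • f x := ((hφ.fderiv_apply v).setIntegral_smul f).symm
    _ = ∫ x in Ω, ∑ i, v i * (f * pd i φ) x := by
      simp only [fderiv_apply_eq_sum_pd, smul_eq_mul, Pi.mul_apply, mul_comm (f _),
        Finset.sum_mul, mul_assoc]
    _ = 0 := by
      rw [integral_finsetSum _ fun i _ => (hf.integrable_mul (hφ.memLp_pd i)).const_mul (v i)]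
      simp only [integral_const_mul, Pi.mul_apply, h _ φ hφ, mul_zero, Finset.sum_const_zero]

lemma isFiniteMeasure_vol (hΩ : Bornology.IsBounded Ω) : IsFiniteMeasure (vol Ω) :=
  isFiniteMeasure_restrict.2 hΩ.measure_lt_top.ne

theorem IsFlow.pressure_unique {t₀ t₁ : ℝ} (hΩ : IsOpen Ω) (hΩb : Bornology.IsBounded Ω)
    (hΩc : IsConnected Ω) {D : Data Ω t₀ t₁} {u : Vel Ω} {p q : Pres Ω} (hp : IsFlow D u p)
    (hq : IsFlow D u q) : p = q := by
  have := isFiniteMeasure_vol hΩb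
  have hpi := (Lp.memLp p).integrable one_le_two
  have hqi := (Lp.memLp q).integrable one_le_two
  obtain ⟨c, hc⟩ : ∃ c, (fun x => p x - q x) =ᵐ[vol Ω] fun _ => c := by
    refine (hasZeroWeakFDeriv_of_integral_mul_pd ((Lp.memLp p).sub (Lp.memLp q))
      fun i φ hφ => ?_).exists_ae_eq_const hΩ hΩc (hpi.sub hqi)
    have hsub := integral_sub ((Lp.memLp p).integrable_mul (hφ.memLp_pd i))
      ((Lp.memLp q).integrable_mul (hφ.memLp_pd i))
    simp only [Pi.mul_apply, Pi.sub_apply, ← sub_mul] at hsub ⊢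
    linarith [hp.2.2.2 i φ hφ, hq.2.2.2 i φ hφ]
  have hmean : ∫ x in Ω, (p x - q x) = 0 := by
    rw [integral_sub hpi hqi, hp.2.2.1, hq.2.2.1, sub_zero]
  have hc₀ : c = 0 := by
    have hpos : volume.real Ω ≠ 0 :=
      (ENNReal.toReal_pos (hΩ.measure_pos volume hΩc.nonempty).ne' hΩb.measure_lt_top.ne).ne'
    simpa [integral_congr_ae hc, hpos] using hmean
  refine Lp.ext (hc.mono fun x hx => ?_)
  rwa [hc₀, sub_eq_zero] at hx

end Pressure

section AbsoluteContinuity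

variable {E : Type*} [NormedAddCommGroup E] [NormedSpace ℝ E] {a b : ℝ} {f f' x : ℝ → E}

lemma absolutelyContinuousOnInterval_of_dist_le {Y Z : Type*} [PseudoMetricSpace Y]
    [PseudoMetricSpace Z] {f : ℝ → Y} {g : ℝ → Z} (hg : AbsolutelyContinuousOnInterval g a b)
    (h : ∀ s ∈ uIcc a b, ∀ t ∈ uIcc a b, dist (f s) (f t) ≤ dist (g s) (g t)) :
    AbsolutelyContinuousOnInterval f a b := by
  rw [absolutelyContinuousOnInterval_iff] at hg ⊢
  refine fun ε hε => (hg ε hε).imp fun δ ⟨hδ, hgδ⟩ => ⟨hδ, fun I hI hIδ => ?_⟩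
  refine (Finset.sum_le_sum fun i hi => ?_).trans_lt (hgδ I hI hIδ)
  exact h _ (hI.1 i hi).1 _ (hI.1 i hi).2

lemma absolutelyContinuousOnInterval_primitive (hx : IntervalIntegrable x volume a b) :
    AbsolutelyContinuousOnInterval (fun t => ∫ s in a..t, x s) a b := by
  refine absolutelyContinuousOnInterval_of_dist_le
    (hx.norm.absolutelyContinuousOnInterval_intervalIntegral left_mem_uIcc) fun s hs t ht => ?_
  have hxs := hx.mono_set (uIcc_subset_uIcc left_mem_uIcc hs)
  have hxt := hx.mono_set (uIcc_subset_uIcc left_mem_uIcc ht)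
  rw [dist_eq_norm, dist_eq_norm, intervalIntegral.integral_interval_sub_left hxs hxt,
    intervalIntegral.integral_interval_sub_left hxs.norm hxt.norm]
  exact intervalIntegral.norm_integral_le_abs_integral_norm

variable [CompleteSpace E]

theorem integral_eq_sub_of_ae_hasDerivAt (hf : AbsolutelyContinuousOnInterval f a b)
    (hderiv : ∀ᵐ t, t ∈ uIcc a b → HasDerivAt f (f' t) t)
    (hf' : IntervalIntegrable f' volume a b) : ∫ t in a..b, f' t = f b - f a := by
  obtain ⟨C, hC⟩ :=
    (hf.sub (absolutelyContinuousOnInterval_primitive hf')).const_of_ae_hasDerivAt_zero <| by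
      filter_upwards [hderiv, hf'.ae_hasDerivAt_integral] with t hft hprim ht
      simpa using (hft ht).sub (hprim ht a left_mem_uIcc)
  have ha := hC a left_mem_uIcc
  have hb := hC b right_mem_uIcc
  simp only [Pi.sub_apply, intervalIntegral.integral_same, sub_zero] at ha hb
  rw [ha, ← hb, sub_sub_cancel]

theorem integral_smul_eq_sub_integral_deriv_smul {ψ : ℝ → ℝ} (hψ : ContDiff ℝ 1 ψ)
    (hf : AbsolutelyContinuousOnInterval f a b)
    (hderiv : ∀ᵐ t, t ∈ uIcc a b → HasDerivAt f (f' t) t)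
    (hf' : IntervalIntegrable f' volume a b) :
    ∫ t in a..b, ψ t • f' t = ψ b • f b - ψ a • f a - ∫ t in a..b, deriv ψ t • f t := by
  have hψf' := hf'.continuousOn_smul hψ.continuous.continuousOn
  have hψ'f : IntervalIntegrable (fun t => deriv ψ t • f t) volume a b :=
    ((hψ.continuous_deriv le_rfl).continuousOn.smul hf.continuousOn).intervalIntegrable
  rw [eq_sub_iff_add_eq, ← intervalIntegral.integral_add hψf' hψ'f]
  refine integral_eq_sub_of_ae_hasDerivAt (f := fun t => ψ t • f t)
    (hψ.contDiffOn.absolutelyContinuousOnInterval.smul hf) ?_ (hψf'.add hψ'f)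
  filter_upwards [hderiv] with t hft ht
  exact (hψ.differentiable (by simp) t).hasDerivAt.smul (hft ht)

theorem integral_inner_deriv_eq {H : Type*} [NormedAddCommGroup H] [InnerProductSpace ℝ H]
    {f f' : ℝ → H} (hf : AbsolutelyContinuousOnInterval f a b)
    (hderiv : ∀ᵐ t, t ∈ uIcc a b → HasDerivAt f (f' t) t)
    (hf' : IntervalIntegrable f' volume a b) :
    ∫ t in a..b, ⟪f t, f' t⟫ = (‖f b‖ ^ 2 - ‖f a‖ ^ 2) / 2 := by
  have hnorm : AbsolutelyContinuousOnInterval (fun t => ‖f t‖) a b :=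
    absolutelyContinuousOnInterval_of_dist_le hf fun s _ t _ =>
      (dist_norm_norm_le (f s) (f t)).trans_eq (dist_eq_norm _ _).symm
  have hint : IntervalIntegrable (fun t => ⟪f t, f' t⟫) volume a b := by
    obtain ⟨C, hC⟩ := isCompact_uIcc.exists_bound_of_continuousOn hf.continuousOn
    refine (hf'.norm.const_mul C).mono_fun ?_ ?_
    · exact ((hf.continuousOn.mono uIoc_subset_uIcc).aestronglyMeasurable measurableSet_uIoc).inner
        hf'.aestronglyMeasurable_restrict_uIoc
    · filter_upwards [ae_restrict_mem measurableSet_uIoc] with t ht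
      refine (norm_inner_le_norm _ _).trans (le_trans ?_ (le_abs_self _))
      exact mul_le_mul_of_nonneg_right (hC t (uIoc_subset_uIcc ht)) (norm_nonneg _)
  have hsq := integral_eq_sub_of_ae_hasDerivAt (f := fun t => ‖f t‖ * ‖f t‖) (hnorm.mul hnorm)
    (f' := fun t => 2 * ⟪f t, f' t⟫) ?_ (hint.const_mul 2)
  · rw [intervalIntegral.integral_const_mul] at hsq
    linarith
  · filter_upwards [hderiv] with t hft ht
    simpa only [← sq] using (hft ht).norm_sq

lemma integral_inner_primitive_nonneg {H : Type*} [NormedAddCommGroup H] [InnerProductSpace ℝ H]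
    [CompleteSpace H] {x : ℝ → H} (hab : a ≤ b) (hx : IntegrableOn x (Ioo a b)) :
    0 ≤ ∫ t in Ioo a b, ⟪∫ s in a..t, x s, x t⟫ := by
  have hxi := (intervalIntegrable_iff_integrableOn_Ioo_of_le hab).2 hx
  have hsq := integral_inner_deriv_eq (absolutelyContinuousOnInterval_primitive hxi)
    (hxi.ae_hasDerivAt_integral.mono fun t h ht => h ht a left_mem_uIcc) hxi
  rw [intervalIntegral.integral_same, norm_zero, zero_pow two_ne_zero, sub_zero,
    intervalIntegral.integral_of_le hab, integral_Ioc_eq_integral_Ioo] at hsq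
  rw [hsq]
  positivity

end AbsoluteContinuity

section WeakTimeDerivative

variable {E E' : Type*} [NormedAddCommGroup E] [NormedSpace ℝ E] [NormedAddCommGroup E']
  [NormedSpace ℝ E'] {t₀ t₁ : ℝ} {y y₁ y₂ x x₁ x₂ : ℝ → E} {c c₁ c₂ : E} {ψ : ℝ → ℝ}

/-- `y' = x` on `(t₀, t₁)` and `y t₀ = c`, in the weak sense: the test functions vanish near `t₁`
but not at `t₀`. -/
def HasWeakDerivFrom (t₀ t₁ : ℝ) (y x : ℝ → E) (c : E) : Prop :=
  ∀ ψ, IsTest (Iio t₁) ψ →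
    ∫ t in Ioo t₀ t₁, deriv ψ t • y t = -(∫ t in Ioo t₀ t₁, ψ t • x t) - ψ t₀ • c

lemma IsTest.deriv {U : Set ℝ} (hψ : IsTest U ψ) : IsTest U (deriv ψ) :=
  hψ.fderiv_apply 1

lemma exists_isTest_Iio_eq_one (ht : t₀ < t₁) : ∃ ψ, IsTest (Iio t₁) ψ ∧ ψ t₀ = 1 := by
  obtain ⟨ψ, htsupp, hcompact, hsmooth, -, hone⟩ :=
    exists_contDiff_tsupport_subset (n := ⊤) (Iio_mem_nhds ht)
  exact ⟨ψ, ⟨hsmooth, hcompact, htsupp⟩, hone⟩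

lemma integrableOn_continuous_smul (hψ : Continuous ψ) (hy : IntegrableOn y (Ioo t₀ t₁)) :
    IntegrableOn (fun t => ψ t • y t) (Ioo t₀ t₁) := by
  rw [← integrableOn_Icc_iff_integrableOn_Ioo] at hy ⊢
  exact hy.continuousOn_smul hψ.continuousOn isCompact_Icc

lemma HasWeakDerivFrom.congr (h : HasWeakDerivFrom t₀ t₁ y₁ x₁ c)
    (hy : y₁ =ᵐ[tvol t₀ t₁] y₂) (hx : x₁ =ᵐ[tvol t₀ t₁] x₂) :
    HasWeakDerivFrom t₀ t₁ y₂ x₂ c := fun ψ hψ => by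
  rw [← integral_congr_ae (hy.mono fun t ht => congrArg (deriv ψ t • ·) ht),
    ← integral_congr_ae (hx.mono fun t ht => congrArg (ψ t • ·) ht)]
  exact h ψ hψ

lemma HasWeakDerivFrom.add_smul (h₁ : HasWeakDerivFrom t₀ t₁ y₁ x₁ c₁)
    (h₂ : HasWeakDerivFrom t₀ t₁ y₂ x₂ c₂) (hy₁ : IntegrableOn y₁ (Ioo t₀ t₁))
    (hx₁ : IntegrableOn x₁ (Ioo t₀ t₁)) (hy₂ : IntegrableOn y₂ (Ioo t₀ t₁))
    (hx₂ : IntegrableOn x₂ (Ioo t₀ t₁)) (s : ℝ) :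
    HasWeakDerivFrom t₀ t₁ (fun t => y₁ t + s • y₂ t) (fun t => x₁ t + s • x₂ t)
      (c₁ + s • c₂) := fun ψ hψ => by
  have hsum {χ : ℝ → ℝ} (hχ : Continuous χ) {z₁ z₂ : ℝ → E} (hz₁ : IntegrableOn z₁ (Ioo t₀ t₁))
      (hz₂ : IntegrableOn z₂ (Ioo t₀ t₁)) :
      ∫ t in Ioo t₀ t₁, χ t • (z₁ t + s • z₂ t)
        = (∫ t in Ioo t₀ t₁, χ t • z₁ t) + s • ∫ t in Ioo t₀ t₁, χ t • z₂ t := by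
    rw [← integral_smul, ← integral_add (integrableOn_continuous_smul hχ hz₁)
      ((integrableOn_continuous_smul hχ hz₂).fun_smul s)]
    simp only [smul_add, smul_comm (χ _) s]
  rw [hsum hψ.deriv.1.continuous hy₁ hy₂, hsum hψ.1.continuous hx₁ hx₂, h₁ ψ hψ, h₂ ψ hψ]
  module

lemma HasWeakDerivFrom.clm [CompleteSpace E] [CompleteSpace E']
    (h : HasWeakDerivFrom t₀ t₁ y x c) (hy : IntegrableOn y (Ioo t₀ t₁))
    (hx : IntegrableOn x (Ioo t₀ t₁)) (L : E →L[ℝ] E') :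
    HasWeakDerivFrom t₀ t₁ (fun t => L (y t)) (fun t => L (x t)) (L c) := fun ψ hψ => by
  have hL := congrArg L (h ψ hψ)
  simp only [map_sub, map_neg, map_smul] at hL
  rw [← L.integral_comp_comm (integrableOn_continuous_smul hψ.deriv.1.continuous hy),
    ← L.integral_comp_comm (integrableOn_continuous_smul hψ.1.continuous hx)] at hL
  simpa only [map_smul] using hL

lemma hasWeakDerivFrom_iff_inner {V : Type*} [NormedAddCommGroup V] [InnerProductSpace ℝ V]
    [CompleteSpace V] {S : Set V} (hS : Dense S) {y x : ℝ → V} {c : V}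
    (hy : IntegrableOn y (Ioo t₀ t₁)) (hx : IntegrableOn x (Ioo t₀ t₁)) :
    HasWeakDerivFrom t₀ t₁ y x c ↔
      ∀ w ∈ S, HasWeakDerivFrom t₀ t₁ (fun t => ⟪w, y t⟫) (fun t => ⟪w, x t⟫) ⟪w, c⟫ := by
  refine ⟨fun h w _ => h.clm hy hx (innerSL ℝ w), fun h ψ hψ => ?_⟩
  refine hS.eq_of_inner_right (𝕜 := ℝ) fun w hw => ?_
  rw [inner_sub_right, inner_neg_right, inner_smul_right,
    ← integral_inner (integrableOn_continuous_smul hψ.deriv.1.continuous hy),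
    ← integral_inner (integrableOn_continuous_smul hψ.1.continuous hx)]
  simpa only [inner_smul_right, smul_eq_mul] using h w hw ψ hψ

variable [CompleteSpace E]

lemma hasWeakDerivFrom_primitive (ht : t₀ ≤ t₁) (hx : IntegrableOn x (Ioo t₀ t₁)) (c : E) :
    HasWeakDerivFrom t₀ t₁ (fun t => c + ∫ s in t₀..t, x s) x c := fun ψ hψ => by
  have hxi := (intervalIntegrable_iff_integrableOn_Ioo_of_le ht).2 hx
  have hparts := integral_smul_eq_sub_integral_deriv_smul (hψ.1.of_le (by simp))
    ((LipschitzWith.const c).lipschitzOnWith.absolutelyContinuousOnInterval.add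
      (absolutelyContinuousOnInterval_primitive hxi))
    (by
      filter_upwards [hxi.ae_hasDerivAt_integral] with t hprim ht'
      exact (hprim ht' t₀ left_mem_uIcc).const_add c) hxi
  simp only [intervalIntegral.integral_of_le ht, integral_Ioc_eq_integral_Ioo, Pi.add_apply,
    intervalIntegral.integral_same, add_zero, hψ.eq_zero_of_notMem self_notMem_Iio, zero_smul,
    zero_sub] at hparts
  rw [hparts]
  abel

/-- The difference of `y` and a primitive of `x` has zero weak derivative. -/
lemma exists_ae_eq_add_primitive (ht : t₀ < t₁) (hy : IntegrableOn y (Ioo t₀ t₁))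
    (hx : IntegrableOn x (Ioo t₀ t₁))
    (h : ∀ ψ, IsTest (Ioo t₀ t₁) ψ →
      ∫ t in Ioo t₀ t₁, deriv ψ t • y t = -∫ t in Ioo t₀ t₁, ψ t • x t) :
    ∃ c, y =ᵐ[tvol t₀ t₁] fun t => c + ∫ s in t₀..t, x s := by
  have hX : IntegrableOn (fun t => ∫ s in t₀..t, x s) (Ioo t₀ t₁) := by
    rw [← intervalIntegrable_iff_integrableOn_Ioo_of_le ht.le] at hx ⊢
    exact (absolutelyContinuousOnInterval_primitive hx).continuousOn.intervalIntegrable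
  have hzero : HasZeroWeakFDeriv volume (Ioo t₀ t₁) fun t => y t - ∫ s in t₀..t, x s := by
    intro ψ hψ v
    have hprim := hasWeakDerivFrom_primitive ht.le hx 0 ψ (hψ.mono Ioo_subset_Iio_self)
    simp only [zero_add, smul_zero, sub_zero] at hprim
    rw [← (hψ.fderiv_apply v).setIntegral_smul]
    simp only [fderiv_eq_smul_deriv, smul_assoc]
    rw [integral_smul]
    simp only [smul_sub]
    rw [integral_sub (integrableOn_continuous_smul hψ.deriv.1.continuous hy)
      (integrableOn_continuous_smul hψ.deriv.1.continuous hX), h ψ hψ, hprim, sub_self, smul_zero]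
  obtain ⟨c, hc⟩ := hzero.exists_ae_eq_const isOpen_Ioo (isConnected_Ioo ht) (hy.sub hX)
  exact ⟨c, hc.mono fun t ht => sub_eq_iff_eq_add.1 ht⟩

theorem exists_hasWeakDerivFrom (ht : t₀ < t₁) (hy : IntegrableOn y (Ioo t₀ t₁))
    (hx : IntegrableOn x (Ioo t₀ t₁))
    (h : ∀ ψ, IsTest (Ioo t₀ t₁) ψ →
      ∫ t in Ioo t₀ t₁, deriv ψ t • y t = -∫ t in Ioo t₀ t₁, ψ t • x t) :
    ∃ c, HasWeakDerivFrom t₀ t₁ y x c := by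
  obtain ⟨c, hc⟩ := exists_ae_eq_add_primitive ht hy hx h
  exact ⟨c, (hasWeakDerivFrom_primitive ht.le hx c).congr hc.symm .rfl⟩

theorem HasWeakDerivFrom.ae_eq (h : HasWeakDerivFrom t₀ t₁ y x c) (ht : t₀ < t₁)
    (hy : IntegrableOn y (Ioo t₀ t₁)) (hx : IntegrableOn x (Ioo t₀ t₁)) :
    y =ᵐ[tvol t₀ t₁] fun t => c + ∫ s in t₀..t, x s := by
  obtain ⟨c', hc'⟩ := exists_ae_eq_add_primitive ht hy hx fun ψ hψ => by
    rw [h ψ (hψ.mono Ioo_subset_Iio_self), hψ.eq_zero_of_notMem left_notMem_Ioo, zero_smul,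
      sub_zero]
  obtain ⟨ψ, hψ, hone⟩ := exists_isTest_Iio_eq_one ht
  have heq := ((hasWeakDerivFrom_primitive ht.le hx c').congr hc'.symm .rfl ψ hψ).symm.trans
    (h ψ hψ)
  rw [hone, one_smul, one_smul, sub_right_inj] at heq
  rwa [heq] at hc'

end WeakTimeDerivative

/-- Lions' representation lemma. -/
theorem exists_forall_inner_eq {Φ X : Type*} [AddCommGroup Φ] [Module ℝ Φ]
    [NormedAddCommGroup X] [InnerProductSpace ℝ X] [CompleteSpace X] (K : Φ →ₗ[ℝ] X)
    (L : Φ →ₗ[ℝ] ℝ) {C : ℝ} (h : ∀ f, |L f| ≤ C * ‖K f‖) : ∃ v : X, ∀ f, ⟪v, K f⟫ = L f := by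
  obtain ⟨g, hg⟩ := K.rangeRestrict.exists_rightInverse_of_surjective K.range_rangeRestrict
  have hKg (x : LinearMap.range K) : K (g x) = x :=
    congrArg Subtype.val (LinearMap.congr_fun hg x)
  obtain ⟨l, hl, -⟩ := exists_extension_norm_eq (LinearMap.range K)
    ((L ∘ₗ g).mkContinuous C fun x => by simpa [hKg] using h (g x))
  refine ⟨(InnerProductSpace.toDual ℝ X).symm l, fun f => ?_⟩
  have hker : L (g (K.rangeRestrict f) - f) = 0 := by
    simpa [hKg] using h (g (K.rangeRestrict f) - f)
  rw [InnerProductSpace.toDual_symm_apply]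
  refine (hl (K.rangeRestrict f)).trans ?_
  rwa [map_sub, sub_eq_zero] at hker

lemma le_div_of_mul_sq_add_le {c x y k : ℝ} (hc : 0 < c) (hx : 0 ≤ x) (hk : 0 ≤ k)
    (h : c * x ^ 2 + y ^ 2 / 2 ≤ x * k) : x ≤ k / c := by
  rw [le_div_iff₀ hc]
  rcases hx.eq_or_lt with rfl | hx
  · simpa using hk
  · nlinarith [sq_nonneg y]

lemma le_sqrt_mul_of_mul_sq_add_le {c x y k : ℝ} (hc : 0 < c) (hx : 0 ≤ x) (hk : 0 ≤ k)
    (h : c * x ^ 2 + y ^ 2 / 2 ≤ x * k) : y ≤ √(2 / c) * k := by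
  have hxk : x * k ≤ k / c * k :=
    mul_le_mul_of_nonneg_right (le_div_of_mul_sq_add_le hc hx hk h) hk
  calc y ≤ √(2 / c * k ^ 2) := Real.le_sqrt_of_sq_le <| by
        have : 2 / c * k ^ 2 = 2 * (k / c * k) := by ring
        nlinarith [mul_nonneg hc.le (sq_nonneg x)]
    _ = √(2 / c) * k := by rw [Real.sqrt_mul (by positivity), Real.sqrt_sq hk]

section ContinuousPaths

variable {E : Type*} [NormedAddCommGroup E] {t₀ t₁ : ℝ}

lemma memLp_tvol_of_continuous {f : ℝ → E} (hf : Continuous f) : MemLp f 2 (tvol t₀ t₁) := by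
  obtain ⟨C, hC⟩ := isCompact_Icc.exists_bound_of_continuousOn (s := Icc t₀ t₁) hf.continuousOn
  refine MemLp.of_bound hf.aestronglyMeasurable C ?_
  filter_upwards [ae_restrict_mem measurableSet_Ioo] with t ht
  exact hC t (Ioo_subset_Icc_self ht)

lemma integrableOn_of_memLp_tvol {f : ℝ → E} (hf : MemLp f 2 (tvol t₀ t₁)) :
    IntegrableOn f (Ioo t₀ t₁) :=
  hf.integrable one_le_two

variable [NormedSpace ℝ E]

/-- The class in `L²(t₀, t₁; E)` of a continuous path. -/
noncomputable def contToLp (t₀ t₁ : ℝ) (E : Type*) [NormedAddCommGroup E] [NormedSpace ℝ E] :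
    C(ℝ, E) →ₗ[ℝ] Lp E 2 (tvol t₀ t₁) where
  toFun f := (memLp_tvol_of_continuous f.continuous).toLp f
  map_add' _ _ := MemLp.toLp_add _ _
  map_smul' _ _ := MemLp.toLp_const_smul _ _

lemma coeFn_contToLp (f : C(ℝ, E)) : contToLp t₀ t₁ E f =ᵐ[tvol t₀ t₁] f :=
  MemLp.coeFn_toLp (memLp_tvol_of_continuous f.continuous)

lemma inner_lp_eq_integral {α E : Type*} {m : MeasurableSpace α} {μ : Measure α}
    [NormedAddCommGroup E] [InnerProductSpace ℝ E] {v w : Lp E 2 μ} {f g : α → E}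
    (hf : v =ᵐ[μ] f) (hg : w =ᵐ[μ] g) : ⟪v, w⟫ = ∫ t, ⟪f t, g t⟫ ∂μ := by
  rw [L2.inner_def]
  refine integral_congr_ae ?_
  filter_upwards [hf, hg] with t hft hgt
  rw [hft, hgt]

variable [CompleteSpace E]

lemma hasDerivAt_integral_continuousMap (g : C(ℝ, E)) (a t : ℝ) :
    HasDerivAt (fun t => ∫ s in a..t, g s) (g t) t :=
  (g.continuous.integral_hasStrictDerivAt a t).hasDerivAt

/-- The primitive vanishing at `a` of a continuous path. -/
noncomputable def primitiveFrom (E : Type*) [NormedAddCommGroup E] [NormedSpace ℝ E]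
    [CompleteSpace E] (a : ℝ) : C(ℝ, E) →ₗ[ℝ] C(ℝ, E) where
  toFun g := ⟨fun t => ∫ s in a..t, g s, continuous_iff_continuousAt.2 fun t =>
    (hasDerivAt_integral_continuousMap g a t).continuousAt⟩
  map_add' f g := by
    ext t
    exact intervalIntegral.integral_add (f.continuous.intervalIntegrable a t)
      (g.continuous.intervalIntegrable a t)
  map_smul' c f := by
    ext t
    exact intervalIntegral.integral_smul c f

lemma hasDerivAt_primitiveFrom (g : C(ℝ, E)) (a t : ℝ) :
    HasDerivAt (primitiveFrom E a g) (g t) t :=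
  hasDerivAt_integral_continuousMap g a t

lemma primitiveFrom_self (g : C(ℝ, E)) (a : ℝ) : primitiveFrom E a g a = 0 :=
  intervalIntegral.integral_same

end ContinuousPaths

section Parabolic

variable {V H : Type*} [NormedAddCommGroup V] [InnerProductSpace ℝ V] [CompleteSpace V]
  [NormedAddCommGroup H] [InnerProductSpace ℝ H] [CompleteSpace H] {t₀ t₁ c : ℝ}
  (ι : V →L[ℝ] H) (A : V →L[ℝ] V)

/-- The backward operator `-ι† ι f' + A† f`, as a function of `f'`, on the `C¹` paths `f` that
vanish at `t₁`. -/
noncomputable def backwardOp (t₀ t₁ : ℝ) : C(ℝ, V) →ₗ[ℝ] Lp V 2 (tvol t₀ t₁) :=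
  contToLp t₀ t₁ V ∘ₗ
    (((A†).compLeftContinuous ℝ ℝ).toLinearMap ∘ₗ primitiveFrom V t₁
      - ((ι† ∘L ι).compLeftContinuous ℝ ℝ).toLinearMap)

lemma coeFn_backwardOp (g : C(ℝ, V)) :
    backwardOp ι A t₀ t₁ g =ᵐ[tvol t₀ t₁] fun t =>
      (A†) (primitiveFrom V t₁ g t) - (ι†) (ι (g t)) :=
  coeFn_contToLp _

variable {ι A}

lemma le_inner_backwardOp (ht : t₀ ≤ t₁) (hA : ∀ v, c * ‖v‖ ^ 2 ≤ ⟪A v, v⟫) (g : C(ℝ, V)) :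
    c * ‖contToLp t₀ t₁ V (primitiveFrom V t₁ g)‖ ^ 2 + ‖ι (primitiveFrom V t₁ g t₀)‖ ^ 2 / 2
      ≤ ⟪contToLp t₀ t₁ V (primitiveFrom V t₁ g), backwardOp ι A t₀ t₁ g⟫ := by
  set f := primitiveFrom V t₁ g
  have hintegrable {y : ℝ → ℝ} (hy : Continuous y) : IntegrableOn y (Ioo t₀ t₁) :=
    integrableOn_of_memLp_tvol (memLp_tvol_of_continuous hy)
  have henergy : ∫ t in Ioo t₀ t₁, ⟪ι (f t), ι (g t)⟫ = -(‖ι (f t₀)‖ ^ 2 / 2) := by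
    have hderiv (t : ℝ) : HasDerivAt (fun t => ι (f t)) (ι (g t)) t :=
      ι.hasFDerivAt.comp_hasDerivAt t (hasDerivAt_primitiveFrom g t₁ t)
    have hftc := intervalIntegral.integral_eq_sub_of_hasDerivAt (a := t₀) (b := t₁)
      (fun t _ => (hderiv t).norm_sq) (Continuous.intervalIntegrable (by fun_prop) _ _)
    rw [intervalIntegral.integral_const_mul, intervalIntegral.integral_of_le ht,
      integral_Ioc_eq_integral_Ioo, primitiveFrom_self, map_zero, norm_zero] at hftc
    linarith
  have hdissipation : c * ‖contToLp t₀ t₁ V f‖ ^ 2 ≤ ∫ t in Ioo t₀ t₁, ⟪A (f t), f t⟫ := by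
    rw [← real_inner_self_eq_norm_sq, inner_lp_eq_integral (coeFn_contToLp f) (coeFn_contToLp f),
      ← integral_const_mul]
    refine integral_mono (hintegrable (by fun_prop)) (hintegrable (by fun_prop)) fun t => ?_
    simpa only [real_inner_self_eq_norm_sq] using hA (f t)
  rw [inner_lp_eq_integral (coeFn_contToLp f) (coeFn_backwardOp ι A g)]
  simp only [inner_sub_right, ContinuousLinearMap.adjoint_inner_right]
  rw [integral_sub (hintegrable (by fun_prop)) (hintegrable (by fun_prop)), henergy]
  linarith

lemma hasWeakDerivFrom_of_inner_backwardOp {F : ℝ → V} (hF : MemLp F 2 (tvol t₀ t₁)) {h : H}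
    {v : Lp V 2 (tvol t₀ t₁)}
    (hv : ∀ g, ⟪v, backwardOp ι A t₀ t₁ g⟫
      = ⟪hF.toLp F, contToLp t₀ t₁ V (primitiveFrom V t₁ g)⟫ + ⟪h, ι (primitiveFrom V t₁ g t₀)⟫) :
    HasWeakDerivFrom t₀ t₁ (fun t => (ι†) (ι (v t))) (fun t => F t - A (v t)) ((ι†) h) := by
  have hvi := integrableOn_of_memLp_tvol (Lp.memLp v)
  have hFi := integrableOn_of_memLp_tvol hF
  have hιv := ι.integrable_comp hvi
  have hAv := A.integrable_comp hvi
  refine (hasWeakDerivFrom_iff_inner dense_univ ((ι†).integrable_comp hιv)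
    (Integrable.sub' hFi hAv)).2 fun w _ ψ hψ => ?_
  let g : C(ℝ, V) := ⟨fun t => deriv ψ t • w, hψ.deriv.1.continuous.smul continuous_const⟩
  have hprim (t : ℝ) : primitiveFrom V t₁ g t = ψ t • w := by
    have hderiv (s : ℝ) : HasDerivAt (fun s => ψ s • w) (g s) s :=
      (hψ.1.differentiable (by simp) s).hasDerivAt.smul_const w
    refine (intervalIntegral.integral_eq_sub_of_hasDerivAt (fun s _ => hderiv s)
      (g.continuous.intervalIntegrable t₁ t)).trans ?_
    rw [hψ.eq_zero_of_notMem self_notMem_Iio, zero_smul, sub_zero]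
  have hvg := hv g
  rw [inner_lp_eq_integral .rfl (coeFn_backwardOp ι A g),
    inner_lp_eq_integral hF.coeFn_toLp (coeFn_contToLp _)] at hvg
  have hcomm (z : V) : ⟪w, z⟫ = ⟪z, w⟫ := real_inner_comm z w
  simp only [hprim, g, ContinuousMap.coe_mk, map_smul, inner_sub_right, inner_smul_right,
    ContinuousLinearMap.adjoint_inner_right] at hvg
  simp only [hcomm, inner_sub_left, smul_eq_mul, mul_sub, ContinuousLinearMap.adjoint_inner_left]
  have hψF := integrableOn_continuous_smul hψ.1.continuous (hFi.inner_const (𝕜 := ℝ) w)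
  have hψA := integrableOn_continuous_smul hψ.1.continuous (hAv.inner_const (𝕜 := ℝ) w)
  have hψι :=
    integrableOn_continuous_smul hψ.deriv.1.continuous (hιv.inner_const (𝕜 := ℝ) (ι w))
  simp only [smul_eq_mul] at hψF hψA hψι
  rw [integral_sub hψF hψA]
  rw [integral_sub hψA hψι] at hvg
  linarith

theorem exists_hasWeakDerivFrom_of_coercive (ht : t₀ ≤ t₁) (hc : 0 < c)
    (hA : ∀ v, c * ‖v‖ ^ 2 ≤ ⟪A v, v⟫) {F : ℝ → V} (hF : MemLp F 2 (tvol t₀ t₁)) (h : H) :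
    ∃ v : Lp V 2 (tvol t₀ t₁),
      HasWeakDerivFrom t₀ t₁ (fun t => (ι†) (ι (v t))) (fun t => F t - A (v t)) ((ι†) h) := by
  let J := contToLp t₀ t₁ V ∘ₗ primitiveFrom V t₁
  let ι₀ : C(ℝ, V) →ₗ[ℝ] H :=
    ι.toLinearMap ∘ₗ (ContinuousMap.evalCLM (M := V) ℝ t₀).toLinearMap ∘ₗ primitiveFrom V t₁
  obtain ⟨v, hv⟩ := exists_forall_inner_eq (backwardOp ι A t₀ t₁)
    ((innerSL ℝ (hF.toLp F)).toLinearMap ∘ₗ J + (innerSL ℝ h).toLinearMap ∘ₗ ι₀)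
    (C := ‖hF.toLp F‖ / c + ‖h‖ * √(2 / c)) fun g => by
      have hbound := (le_inner_backwardOp (ι := ι) ht hA g).trans (real_inner_le_norm _ _)
      calc |⟪hF.toLp F, J g⟫ + ⟪h, ι₀ g⟫|
          ≤ ‖hF.toLp F‖ * ‖J g‖ + ‖h‖ * ‖ι₀ g‖ :=
            (abs_add_le _ _).trans (add_le_add (abs_real_inner_le_norm _ _)
              (abs_real_inner_le_norm _ _))
        _ ≤ ‖hF.toLp F‖ * (‖backwardOp ι A t₀ t₁ g‖ / c)
            + ‖h‖ * (√(2 / c) * ‖backwardOp ι A t₀ t₁ g‖) := by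
          gcongr
          · exact le_div_of_mul_sq_add_le hc (norm_nonneg _) (norm_nonneg _) hbound
          · exact le_sqrt_mul_of_mul_sq_add_le hc (norm_nonneg _) (norm_nonneg _) hbound
        _ = _ := by ring
  exact ⟨v, hasWeakDerivFrom_of_inner_backwardOp hF hv⟩

lemma HasWeakDerivFrom.ae_eq_neg_primitive (ht : t₀ < t₁) {v : ℝ → V}
    (hv : IntegrableOn v (Ioo t₀ t₁))
    (h : HasWeakDerivFrom t₀ t₁ (fun t => (ι†) (ι (v t))) (fun t => -A (v t)) 0) :
    ∀ᵐ t ∂tvol t₀ t₁, (ι†) (ι (v t)) = -A (∫ s in t₀..t, v s) := by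
  have hvi := (intervalIntegrable_iff_integrableOn_Ioo_of_le ht.le).2 hv
  filter_upwards [h.ae_eq ht ((ι†).integrable_comp (ι.integrable_comp hv))
    (A.integrable_comp hv).neg, ae_restrict_mem measurableSet_Ioo] with t hy htI
  have hvt := hvi.mono_set (uIcc_subset_uIcc left_mem_uIcc (Icc_subset_uIcc ⟨htI.1.le, htI.2.le⟩))
  rw [hy, zero_add, intervalIntegral.integral_neg, A.intervalIntegral_comp_comm hvt]

/-- Integrating in time gives `ι† ι v = -A W` for the primitive `W` of `v`; testing with `W` makes
the first term nonnegative. -/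
lemma HasWeakDerivFrom.primitive_ae_eq_zero (ht : t₀ < t₁) (hc : 0 < c)
    (hA : ∀ v, c * ‖v‖ ^ 2 ≤ ⟪A v, v⟫) {v : ℝ → V} (hv : IntegrableOn v (Ioo t₀ t₁))
    (h : HasWeakDerivFrom t₀ t₁ (fun t => (ι†) (ι (v t))) (fun t => -A (v t)) 0) :
    (fun t => ∫ s in t₀..t, v s) =ᵐ[tvol t₀ t₁] 0 := by
  set W := fun t => ∫ s in t₀..t, v s
  have hvi := (intervalIntegrable_iff_integrableOn_Ioo_of_le ht.le).2 hv
  have hW : ContinuousOn W (Icc t₀ t₁) := by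
    simpa only [uIcc_of_le ht.le] using
      (absolutelyContinuousOnInterval_primitive hvi).continuousOn
  have hιW {t : ℝ} (ht : t ∈ uIcc t₀ t₁) : ι (W t) = ∫ s in t₀..t, ι (v s) :=
    (ι.intervalIntegral_comp_comm (hvi.mono_set (uIcc_subset_uIcc left_mem_uIcc ht))).symm
  have henergy : 0 ≤ ∫ t in Ioo t₀ t₁, ⟪ι (W t), ι (v t)⟫ := by
    refine (integral_inner_primitive_nonneg ht.le (ι.integrable_comp hv)).trans_eq
      (setIntegral_congr_fun measurableSet_Ioo fun t htI => ?_)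
    exact congrArg (⟪·, ι (v t)⟫) (hιW (Icc_subset_uIcc ⟨htI.1.le, htI.2.le⟩)).symm
  have hAW : ∫ t in Ioo t₀ t₁, ⟪ι (W t), ι (v t)⟫ = -∫ t in Ioo t₀ t₁, ⟪A (W t), W t⟫ := by
    rw [← integral_neg]
    refine integral_congr_ae ((h.ae_eq_neg_primitive ht hv).mono fun t htW => ?_)
    change ⟪ι (W t), ι (v t)⟫ = -⟪A (W t), W t⟫
    rw [← ContinuousLinearMap.adjoint_inner_right, htW, inner_neg_right, real_inner_comm]
  have hint {y : ℝ → ℝ} (hy : ContinuousOn y (Icc t₀ t₁)) : IntegrableOn y (Ioo t₀ t₁) :=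
    (hy.integrableOn_Icc).mono_set Ioo_subset_Icc_self
  have hsq : ∫ t in Ioo t₀ t₁, c * ‖W t‖ ^ 2 = 0 := by
    refine le_antisymm ?_ (integral_nonneg fun t => by positivity)
    refine (integral_mono (hint (by fun_prop)) (hint (by fun_prop)) fun t => hA (W t)).trans ?_
    linarith
  filter_upwards [(integral_eq_zero_iff_of_nonneg (fun t => by positivity)
    (hint (by fun_prop))).1 hsq] with t ht
  simpa [hc.ne'] using ht

theorem HasWeakDerivFrom.ae_eq_zero_of_coercive (ht : t₀ < t₁) (hι : Function.Injective ι)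
    (hc : 0 < c) (hA : ∀ v, c * ‖v‖ ^ 2 ≤ ⟪A v, v⟫) {v : ℝ → V} (hv : IntegrableOn v (Ioo t₀ t₁))
    (h : HasWeakDerivFrom t₀ t₁ (fun t => (ι†) (ι (v t))) (fun t => -A (v t)) 0) :
    v =ᵐ[tvol t₀ t₁] 0 := by
  filter_upwards [h.ae_eq_neg_primitive ht hv, h.primitive_ae_eq_zero ht hc hA hv] with t hBv hW
  rw [hW, Pi.zero_apply, map_zero, neg_zero] at hBv
  refine (map_eq_zero_iff ι hι).1 (inner_self_eq_zero (𝕜 := ℝ).1 ?_)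
  rw [← ContinuousLinearMap.adjoint_inner_right, hBv, inner_zero_right]

end Parabolic

section WeakSolution

lemma coeFn_add_smul {α E : Type*} {m : MeasurableSpace α} {μ : Measure α} [NormedAddCommGroup E]
    [NormedSpace ℝ E] {p : ℝ≥0∞} (f g : Lp E p μ) (s : ℝ) :
    (f + s • g : Lp E p μ) =ᵐ[μ] fun x => f x + s • g x := by
  filter_upwards [Lp.coeFn_add f (s • g), Lp.coeFn_smul s g] with x hadd hsmul
  rw [hadd, Pi.add_apply, hsmul, Pi.smul_apply]

lemma integrableOn_lp {E : Type*} [NormedAddCommGroup E] {t₀ t₁ : ℝ} (f : Lp E 2 (tvol t₀ t₁)) :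
    IntegrableOn f (Ioo t₀ t₁) :=
  integrableOn_of_memLp_tvol (Lp.memLp f)

lemma integral_mul_inner_sub_inner_add {X H V : Type*} [NormedAddCommGroup X] [NormedSpace ℝ X]
    [NormedAddCommGroup H] [InnerProductSpace ℝ H] [NormedAddCommGroup V] [InnerProductSpace ℝ V]
    {t₀ t₁ : ℝ} {ψ : ℝ → ℝ} (hψ : Continuous ψ) (x : H) (g : Lp H 2 (tvol t₀ t₁)) (w : V)
    (A B : X →L[ℝ] V) (T : Lp X 2 (tvol t₀ t₁)) :
    ∫ t in Ioo t₀ t₁, ψ t * (⟪x, g t⟫ - ⟪w, (A + B) (T t)⟫) =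
      (∫ t in Ioo t₀ t₁, ψ t * ⟪x, g t⟫) - (∫ t in Ioo t₀ t₁, ψ t * ⟪w, A (T t)⟫)
        - ∫ t in Ioo t₀ t₁, ψ t * ⟪w, B (T t)⟫ := by
  have hg : IntegrableOn (fun t => ψ t * ⟪x, g t⟫) (Ioo t₀ t₁) :=
    integrableOn_continuous_smul hψ ((integrableOn_lp g).const_inner x)
  have hT : ∀ L : X →L[ℝ] V, IntegrableOn (fun t => ψ t * ⟪w, L (T t)⟫) (Ioo t₀ t₁) := fun L =>
    integrableOn_continuous_smul hψ ((L.integrable_comp (integrableOn_lp T)).const_inner w)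
  rw [← integral_sub hg (hT A)]
  refine Eq.trans ?_ (integral_sub (hg.sub (hT A)) (hT B))
  refine integral_congr_ae (.of_forall fun t => ?_)
  simp only [add_apply, inner_add_right]
  ring

variable {X H : Type*} [NormedAddCommGroup X] [InnerProductSpace ℝ X] [NormedAddCommGroup H]
  [InnerProductSpace ℝ H] [CompleteSpace H] {t₀ t₁ c : ℝ} {N : X →L[ℝ] H} {M : Submodule ℝ X}
  [CompleteSpace M] {A : X →L[ℝ] M} {g : Lp H 2 (tvol t₀ t₁)} {Tb T : Lp X 2 (tvol t₀ t₁)} {h : H}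

/-- The map `H → M' ≅ M` sending `x` to the functional `w ↦ ⟪N w, x⟫` on `M`. -/
noncomputable def dualEmbedding (N : X →L[ℝ] H) (M : Submodule ℝ X) [CompleteSpace M] :
    H →L[ℝ] M :=
  (N ∘L M.subtypeL)†

lemma inner_dualEmbedding (w : M) (x : H) : ⟪w, dualEmbedding N M x⟫ = ⟪N w, x⟫ :=
  ContinuousLinearMap.adjoint_inner_right _ _ _

/-- `T` is a weak solution of `(N T)' + A T = g`, `T - Tb ∈ M`, `N T (t₀) = h`, the equation and the
initial condition being tested against `M`; the values of `A` are functionals on `M`, identified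
with elements of `M` by Riesz' theorem. -/
def IsWeakSolution (N : X →L[ℝ] H) (A : X →L[ℝ] M) (g : Lp H 2 (tvol t₀ t₁))
    (Tb : Lp X 2 (tvol t₀ t₁)) (h : H) (T : Lp X 2 (tvol t₀ t₁)) : Prop :=
  (∀ᵐ t ∂tvol t₀ t₁, T t - Tb t ∈ M) ∧
  HasWeakDerivFrom t₀ t₁ (fun t => dualEmbedding N M (N (T t)))
    (fun t => dualEmbedding N M (g t) - A (T t)) (dualEmbedding N M h)

lemma integrableOn_source (A : X →L[ℝ] M) (g : Lp H 2 (tvol t₀ t₁)) (T : Lp X 2 (tvol t₀ t₁)) :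
    IntegrableOn (fun t => dualEmbedding N M (g t) - A (T t)) (Ioo t₀ t₁) :=
  ((dualEmbedding N M).integrable_comp (integrableOn_lp g)).sub
    (A.integrable_comp (integrableOn_lp T))

lemma integrableOn_dualEmbedding (T : Lp X 2 (tvol t₀ t₁)) :
    IntegrableOn (fun t => dualEmbedding N M (N (T t))) (Ioo t₀ t₁) :=
  (dualEmbedding N M).integrable_comp (N.integrable_comp (integrableOn_lp T))

lemma isWeakSolution_iff_inner {S : Set M} (hS : Dense S) :
    IsWeakSolution N A g Tb h T ↔ (∀ᵐ t ∂tvol t₀ t₁, T t - Tb t ∈ M) ∧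
      ∀ w ∈ S, HasWeakDerivFrom t₀ t₁ (fun t => ⟪N w, N (T t)⟫)
        (fun t => ⟪N w, g t⟫ - ⟪w, A (T t)⟫) ⟪N w, h⟫ := by
  refine and_congr_right fun _ => ?_
  rw [hasWeakDerivFrom_iff_inner hS (integrableOn_dualEmbedding T) (integrableOn_source A g T)]
  simp only [inner_sub_right, inner_dualEmbedding]

lemma IsWeakSolution.add_smul {g' : Lp H 2 (tvol t₀ t₁)} {Tb' T' : Lp X 2 (tvol t₀ t₁)} {h' : H}
    (hT : IsWeakSolution N A g Tb h T) (hT' : IsWeakSolution N A g' Tb' h' T') (s : ℝ) :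
    IsWeakSolution N A (g + s • g') (Tb + s • Tb') (h + s • h') (T + s • T') := by
  refine ⟨?_, ?_⟩
  · filter_upwards [hT.1, hT'.1, coeFn_add_smul T T' s, coeFn_add_smul Tb Tb' s]
      with t hmem hmem' heq heqb
    rw [heq, heqb, add_sub_add_comm, ← smul_sub]
    exact M.add_mem hmem (M.smul_mem s hmem')
  · have hsum := hT.2.add_smul hT'.2 (integrableOn_dualEmbedding T) (integrableOn_source A g T)
      (integrableOn_dualEmbedding T') (integrableOn_source A g' T') s
    rw [← map_smul, ← map_add] at hsum
    refine hsum.congr ?_ ?_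
    · filter_upwards [coeFn_add_smul T T' s] with t heq
      simp only [heq, map_add, map_smul]
    · filter_upwards [coeFn_add_smul T T' s, coeFn_add_smul g g' s] with t heq heqg
      simp only [heq, heqg, map_add, map_smul]
      module

lemma IsWeakSolution.add_smul_of_homogeneous {T' : Lp X 2 (tvol t₀ t₁)} {h' : H}
    (hT : IsWeakSolution N A g Tb h T) (hT' : IsWeakSolution N A 0 0 h' T') (s : ℝ) :
    IsWeakSolution N A g Tb (h + s • h') (T + s • T') := by
  simpa only [smul_zero, add_zero] using hT.add_smul hT' s

/-- The boundary datum `Tb` has a trace `b` at `t₀`, so that `T - Tb` solves the problem with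
homogeneous boundary condition and initial value `h - b`. -/
lemma exists_isWeakSolution (ht : t₀ < t₁) (hc : 0 < c) (hA : ∀ w : M, c * ‖w‖ ^ 2 ≤ ⟪A w, w⟫)
    (g : Lp H 2 (tvol t₀ t₁)) {G : Lp H 2 (tvol t₀ t₁)}
    (hTb : ∀ ψ, IsTest (Ioo t₀ t₁) ψ →
      ∫ t in Ioo t₀ t₁, deriv ψ t • N (Tb t) = -∫ t in Ioo t₀ t₁, ψ t • G t) (h : H) :
    ∃ T, IsWeakSolution N A g Tb h T := by
  set E := dualEmbedding N M with hE
  obtain ⟨b, hb⟩ := exists_hasWeakDerivFrom ht (N.integrable_comp (integrableOn_lp Tb))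
    (integrableOn_lp G) hTb
  have hb' := hb.clm (N.integrable_comp (integrableOn_lp Tb)) (integrableOn_lp G) E
  have hF : MemLp (fun t => E (g t) - E (G t) - A (Tb t)) 2 (tvol t₀ t₁) :=
    ((E.comp_memLp' (Lp.memLp g)).sub (E.comp_memLp' (Lp.memLp G))).sub
      (A.comp_memLp' (Lp.memLp Tb))
  obtain ⟨v, hv⟩ := exists_hasWeakDerivFrom_of_coercive (ι := N ∘L M.subtypeL)
    (A := A ∘L M.subtypeL) ht.le hc hA hF (h - b)
  have hvi := integrableOn_lp v
  have hsum := hb'.add_smul hv (integrableOn_dualEmbedding Tb)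
    (E.integrable_comp (integrableOn_lp G))
    (E.integrable_comp ((N ∘L M.subtypeL).integrable_comp hvi))
    ((integrableOn_of_memLp_tvol hF).sub ((A ∘L M.subtypeL).integrable_comp hvi)) 1
  have hcoe : ∀ᵐ t ∂tvol t₀ t₁,
      (Tb + M.subtypeL.compLp v : Lp X 2 (tvol t₀ t₁)) t = Tb t + v t := by
    filter_upwards [Lp.coeFn_add Tb (M.subtypeL.compLp v), M.subtypeL.coeFn_compLp v]
      with t hadd hval
    rw [hadd, Pi.add_apply, hval, Submodule.subtypeL_apply]
  refine ⟨Tb + M.subtypeL.compLp v, ?_, ?_⟩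
  · filter_upwards [hcoe] with t heq
    rw [heq, add_sub_cancel_left]
    exact (v t).2
  · rw [one_smul, ← dualEmbedding, ← hE, map_sub, add_sub_cancel] at hsum
    refine hsum.congr ?_ ?_
    · filter_upwards [hcoe] with t heq
      simp only [heq, map_add, one_smul]
      rfl
    · filter_upwards [hcoe] with t heq
      simp only [heq, map_add, one_smul, ContinuousLinearMap.comp_apply, Submodule.subtypeL_apply]
      abel

lemma IsWeakSolution.eq_zero (ht : t₀ < t₁) (hc : 0 < c) (hA : ∀ w : M, c * ‖w‖ ^ 2 ≤ ⟪A w, w⟫)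
    (hN : InjOn N M) (hT : IsWeakSolution N A 0 0 0 T) : T = 0 := by
  have hmem : ∀ᵐ t ∂tvol t₀ t₁, T t = (M.orthogonalProjectionOnto (T t) : X) := by
    filter_upwards [hT.1, Lp.coeFn_zero X 2 (tvol t₀ t₁)] with t hTt hzero
    rw [hzero, Pi.zero_apply, sub_zero] at hTt
    exact (Submodule.starProjection_eq_self_iff.2 hTt).symm
  have hweak : HasWeakDerivFrom t₀ t₁
      (fun t => dualEmbedding N M ((N ∘L M.subtypeL) (M.orthogonalProjectionOnto (T t))))
      (fun t => -(A ∘L M.subtypeL) (M.orthogonalProjectionOnto (T t))) 0 := by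
    rw [← map_zero (dualEmbedding N M)]
    refine hT.2.congr ?_ ?_
    · filter_upwards [hmem] with t heq
      exact congrArg (fun x => dualEmbedding N M (N x)) heq
    · filter_upwards [hmem, Lp.coeFn_zero H 2 (tvol t₀ t₁)] with t heq hzero
      rw [hzero, Pi.zero_apply, map_zero, zero_sub]
      exact congrArg (fun x => -A x) heq
  have hzero := hweak.ae_eq_zero_of_coercive (ι := N ∘L M.subtypeL) ht hN.injective hc hA
    (M.orthogonalProjectionOnto.integrable_comp (integrableOn_lp T))
  refine Lp.ext ?_
  filter_upwards [hmem, hzero, Lp.coeFn_zero X 2 (tvol t₀ t₁)] with t heq hproj hcoe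
  rw [heq, hproj, hcoe, Pi.zero_apply, Submodule.coe_zero, Pi.zero_apply]

theorem existsUnique_isWeakSolution (ht : t₀ < t₁) (hc : 0 < c)
    (hA : ∀ w : M, c * ‖w‖ ^ 2 ≤ ⟪A w, w⟫) (hN : InjOn N M)
    (g : Lp H 2 (tvol t₀ t₁)) {G : Lp H 2 (tvol t₀ t₁)}
    (hTb : ∀ ψ, IsTest (Ioo t₀ t₁) ψ →
      ∫ t in Ioo t₀ t₁, deriv ψ t • N (Tb t) = -∫ t in Ioo t₀ t₁, ψ t • G t) (h : H) :
    ∃! T, IsWeakSolution N A g Tb h T := by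
  obtain ⟨T, hT⟩ := exists_isWeakSolution ht hc hA g hTb h
  refine ⟨T, hT, fun T' hT' => ?_⟩
  have hdiff := hT'.add_smul hT (-1)
  simp only [neg_smul, one_smul, add_neg_cancel] at hdiff
  exact add_neg_eq_zero.1 (hdiff.eq_zero ht hc hA hN)

end WeakSolution

section SobolevSpace

variable {d : ℕ} {Ω : Set (Pt d)} {φ : Pt d → ℝ}

/-- The inclusion `H¹(Ω) → L²(Ω)`. -/
noncomputable def valL (Ω : Set (Pt d)) : H1 Ω →L[ℝ] Lp ℝ 2 (vol Ω) :=
  WithLp.fstL 2 ℝ _ _ ∘L (H1 Ω).subtypeL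

/-- The weak gradient `H¹(Ω) → L²(Ω; ℝ^d)`. -/
noncomputable def gradL (Ω : Set (Pt d)) : H1 Ω →L[ℝ] Lp (Pt d) 2 (vol Ω) :=
  WithLp.sndL 2 ℝ _ _ ∘L (H1 Ω).subtypeL

lemma valL_apply (v : H1 Ω) : valL Ω v = val v := rfl

lemma norm_sq_eq (v : H1 Ω) : ‖v‖ ^ 2 = ‖val v‖ ^ 2 + ‖grad v‖ ^ 2 :=
  WithLp.prod_norm_sq_eq_of_L2 v.1

lemma norm_grad_le (v : H1 Ω) : ‖grad v‖ ≤ ‖v‖ :=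
  le_of_sq_le_sq (by rw [norm_sq_eq]; exact le_add_of_nonneg_left (sq_nonneg _)) (norm_nonneg v)

lemma inner_lp_eq_integral_mul {α : Type*} {_ : MeasurableSpace α} {μ : Measure α}
    {v w : Lp ℝ 2 μ} {f g : α → ℝ} (hf : v =ᵐ[μ] f) (hg : w =ᵐ[μ] g) :
    ⟪v, w⟫ = ∫ x, f x * g x ∂μ :=
  (inner_lp_eq_integral hf hg).trans <| integral_congr_ae <| .of_forall fun _ => mul_comm _ _

lemma IsTest.memLp_smul_const {E : Type*} [NormedAddCommGroup E] [NormedSpace ℝ E]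
    (hφ : IsTest Ω φ) (v : E) : MemLp (fun x => φ x • v) 2 (vol Ω) :=
  (hφ.1.continuous.smul continuous_const).memLp_of_hasCompactSupport hφ.2.1.smul_right

lemma isWeakGrad_iff_inner {v : Lp ℝ 2 (vol Ω)} {g : Lp (Pt d) 2 (vol Ω)} :
    IsWeakGrad Ω v g ↔ ∀ (i : Fin d) (φ : Pt d → ℝ) (hφ : IsTest Ω φ),
      ⟪v, (hφ.memLp_pd i).toLp⟫ +
        ⟪g, (hφ.memLp_smul_const (EuclideanSpace.single i (1 : ℝ))).toLp⟫ = 0 := by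
  refine forall_congr' fun i => forall_congr' fun φ => forall_congr' fun hφ => ?_
  rw [inner_lp_eq_integral_mul .rfl (hφ.memLp_pd i).coeFn_toLp,
    inner_lp_eq_integral .rfl (hφ.memLp_smul_const _).coeFn_toLp, add_eq_zero_iff_eq_neg]
  simp [real_inner_smul_right, EuclideanSpace.inner_single_right, mul_comm]

lemma isClosed_H1 (Ω : Set (Pt d)) :
    IsClosed (H1 Ω : Set (WithLp 2 (Lp ℝ 2 (vol Ω) × Lp (Pt d) 2 (vol Ω)))) := by
  have hset : (H1 Ω : Set (WithLp 2 (Lp ℝ 2 (vol Ω) × Lp (Pt d) 2 (vol Ω)))) =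
      ⋂ (i : Fin d) (φ : Pt d → ℝ) (hφ : IsTest Ω φ), {z | ⟪z.fst, (hφ.memLp_pd i).toLp⟫ +
        ⟪z.snd, (hφ.memLp_smul_const (EuclideanSpace.single i (1 : ℝ))).toLp⟫ = 0} := by
    ext z
    simp only [mem_iInter]
    exact isWeakGrad_iff_inner
  rw [hset]
  refine isClosed_iInter fun i => isClosed_iInter fun φ => isClosed_iInter fun hφ =>
    isClosed_eq (.add ?_ ?_) continuous_const
  · exact (WithLp.fstL 2 ℝ _ _).continuous.inner continuous_const
  · exact (WithLp.sndL 2 ℝ _ _).continuous.inner continuous_const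

instance : CompleteSpace (H1 Ω) := (isClosed_H1 Ω).completeSpace_coe

instance : CompleteSpace (H10 Ω) :=
  (Submodule.isClosed_topologicalClosure (testH1 Ω)).completeSpace_coe

end SobolevSpace

section TestFunctions

variable {d : ℕ} {Ω : Set (Pt d)} {φ χ : Pt d → ℝ}

lemma gradient_apply_eq_pd (φ : Pt d → ℝ) (x : Pt d) (i : Fin d) :
    gradient φ x i = pd i φ x := by
  rw [pd, ← toDual_gradient, InnerProductSpace.toDual_apply_apply,
    EuclideanSpace.inner_single_right]
  simp

lemma norm_gradient (φ : Pt d → ℝ) (x : Pt d) : ‖gradient φ x‖ = ‖fderiv ℝ φ x‖ :=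
  LinearIsometryEquiv.norm_map _ _

lemma inner_gradient (v : Pt d) (φ : Pt d → ℝ) (x : Pt d) :
    ⟪v, gradient φ x⟫ = ∑ j, v j * pd j φ x := by
  simp only [PiLp.inner_apply, gradient_apply_eq_pd, RCLike.inner_apply, conj_trivial, mul_comm]

lemma IsTest.memLp_gradient (hφ : IsTest Ω φ) : MemLp (gradient φ) 2 (vol Ω) :=
  ((InnerProductSpace.toDual ℝ (Pt d)).symm.continuous.comp
    (hφ.1.continuous_fderiv (by simp))).memLp_of_hasCompactSupport
    ((hφ.2.1.fderiv (𝕜 := ℝ)).comp_left (map_zero _))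

lemma IsTest.mul (hφ : IsTest Ω φ) (hχ : IsTest Ω χ) : IsTest Ω fun x => φ x * χ x :=
  ⟨hφ.1.mul hχ.1, hφ.2.1.mul_right,
    (closure_mono (Function.support_mul_subset_left _ _)).trans hφ.2.2⟩

lemma IsTest.pd_mul (hφ : IsTest Ω φ) (hχ : IsTest Ω χ) (i : Fin d) (x : Pt d) :
    pd i (fun x => φ x * χ x) x = φ x * pd i χ x + χ x * pd i φ x := by
  simp only [pd, fderiv_fun_mul (hφ.1.differentiable (by simp) x)
    (hχ.1.differentiable (by simp) x), add_apply, smul_apply, smul_eq_mul]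

lemma IsTest.integral_mul_pd (hφ : IsTest Ω φ) (hχ : IsTest Ω χ) (i : Fin d) :
    ∫ x in Ω, φ x * pd i χ x = -∫ x in Ω, pd i φ x * χ x := by
  have hintegrable : ∀ {f g : Pt d → ℝ}, IsTest Ω f → IsTest Ω g →
      Integrable fun x => f x * g x := fun hf hg =>
    (hf.mul hg).1.continuous.integrable_of_hasCompactSupport (hf.mul hg).2.1
  refine (hφ.setIntegral_smul _).trans (.trans ?_
    (congrArg Neg.neg ((hφ.fderiv_apply _).setIntegral_smul χ)).symm)
  exact integral_mul_fderiv_eq_neg_fderiv_mul_of_integrable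
    (hintegrable (hφ.fderiv_apply _) hχ) (hintegrable hφ (hχ.fderiv_apply _))
    (hintegrable hφ hχ) (fun x _ => hφ.1.differentiable (by simp) x)
    fun x _ => hχ.1.differentiable (by simp) x

lemma IsTest.isWeakGrad (hφ : IsTest Ω φ) :
    IsWeakGrad Ω hφ.memLp.toLp hφ.memLp_gradient.toLp := by
  intro i χ hχ
  have hleft : ∀ᵐ x ∂vol Ω, hφ.memLp.toLp φ x * pd i χ x = φ x * pd i χ x := by
    filter_upwards [hφ.memLp.coeFn_toLp] with x hx
    rw [hx]
  have hright : ∀ᵐ x ∂vol Ω, hφ.memLp_gradient.toLp (gradient φ) x i * χ x = pd i φ x * χ x := by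
    filter_upwards [hφ.memLp_gradient.coeFn_toLp] with x hx
    rw [hx, gradient_apply_eq_pd]
  rw [integral_congr_ae hleft, integral_congr_ae hright, hφ.integral_mul_pd hχ]

/-- The class in `H¹(Ω)` of a test function. -/
noncomputable def IsTest.toH1 (hφ : IsTest Ω φ) : H1 Ω :=
  ⟨WithLp.toLp 2 (hφ.memLp.toLp, hφ.memLp_gradient.toLp), hφ.isWeakGrad⟩

lemma IsTest.val_toH1 (hφ : IsTest Ω φ) : val hφ.toH1 =ᵐ[vol Ω] φ :=
  hφ.memLp.coeFn_toLp

lemma IsTest.grad_toH1 (hφ : IsTest Ω φ) : grad hφ.toH1 =ᵐ[vol Ω] gradient φ :=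
  hφ.memLp_gradient.coeFn_toLp

lemma IsTest.toH1_mem_testH1 (hφ : IsTest Ω φ) : hφ.toH1 ∈ testH1 Ω :=
  ⟨φ, hφ, hφ.val_toH1⟩

/-- The class in `H¹₀(Ω)` of a test function. -/
noncomputable def IsTest.toH10 (hφ : IsTest Ω φ) : H10 Ω :=
  ⟨hφ.toH1, (testH1 Ω).le_topologicalClosure hφ.toH1_mem_testH1⟩

lemma IsTest.coe_toH10 (hφ : IsTest Ω φ) : (hφ.toH10 : H1 Ω) = hφ.toH1 := rfl

lemma ae_eq_zero_of_integral_mul_test (hΩ : IsOpen Ω) {f : Pt d → ℝ} (hf : MemLp f 2 (vol Ω))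
    (h : ∀ φ, IsTest Ω φ → ∫ x in Ω, f x * φ x = 0) : f =ᵐ[vol Ω] 0 := by
  have hloc : LocallyIntegrableOn f Ω := by
    refine (locallyIntegrableOn_iff hΩ.isLocallyClosed).2 fun K hK hKc => ?_
    have : IsFiniteMeasure (volume.restrict K) := ⟨by simpa using hKc.measure_lt_top⟩
    exact (hf.mono_measure (Measure.restrict_mono hK le_rfl)).integrable one_le_two
  refine (ae_restrict_iff' hΩ.measurableSet).2 <|
    hΩ.ae_eq_zero_of_integral_contDiff_smul_eq_zero hloc fun φ hsmooth hcompact hsupp => ?_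
  have hφ : IsTest Ω φ := ⟨hsmooth, hcompact, hsupp⟩
  rw [← hφ.setIntegral_smul, ← h φ hφ]
  simp only [smul_eq_mul, mul_comm]

lemma valL_injective (hΩ : IsOpen Ω) : Function.Injective (valL Ω) := by
  refine (injective_iff_map_eq_zero _).2 fun v (hv : val v = 0) => ?_
  have hcoord : ∀ i, (fun x => grad v x i) =ᵐ[vol Ω] 0 := fun i =>
    ae_eq_zero_of_integral_mul_test hΩ (memLp_coord (grad v) i) fun φ hφ => by
      refine neg_eq_zero.1 ((v.2 i φ hφ).symm.trans (integral_eq_zero_of_ae ?_))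
      filter_upwards [Lp.coeFn_zero ℝ 2 (vol Ω)] with x hx
      rw [show v.1.fst = 0 from hv, hx]
      exact zero_mul _
  have hgrad : grad v = 0 := by
    refine Lp.ext ?_
    filter_upwards [ae_all_iff.2 hcoord, Lp.coeFn_zero (Pt d) 2 (vol Ω)] with x hx hzero
    rw [hzero]
    exact PiLp.ext hx
  simpa [hv, hgrad] using norm_sq_eq v

lemma exists_eq_toH1 (hΩ : IsOpen Ω) {v : H1 Ω} (hv : v ∈ testH1 Ω) :
    ∃ φ, ∃ hφ : IsTest Ω φ, hφ.toH1 = v := by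
  obtain ⟨φ, hφ, hvφ⟩ := hv
  exact ⟨φ, hφ, valL_injective hΩ (Lp.ext (hφ.val_toH1.trans hvφ.symm))⟩

lemma dense_toH10 (hΩ : IsOpen Ω) : Dense {w | ∃ φ, ∃ hφ : IsTest Ω φ, hφ.toH10 = w} := by
  intro w
  rw [closure_subtype]
  refine closure_mono (fun v hv => ?_) w.2
  obtain ⟨φ, hφ, rfl⟩ := exists_eq_toH1 hΩ hv
  exact ⟨hφ.toH10, ⟨φ, hφ, rfl⟩, rfl⟩

end TestFunctions

section SobolevInequality

open Module (finrank)

section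

variable {V : Type*} [NormedAddCommGroup V] [NormedSpace ℝ V] [FiniteDimensional ℝ V]
  [MeasurableSpace V] [BorelSpace V] {μ : Measure V} [μ.IsAddHaarMeasure] {U : Set V} {p q : ℝ≥0}

lemma IsTest.eLpNorm_le_eLpNorm_fderiv {φ : V → ℝ} (hφ : IsTest U φ) (hU : Bornology.IsBounded U)
    (hp : 1 ≤ p) (hpV : p < finrank ℝ V) (hpq : (p : ℝ)⁻¹ - (finrank ℝ V : ℝ)⁻¹ ≤ (q : ℝ)⁻¹) :
    eLpNorm φ q (μ.restrict U) ≤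
      eLpNormLESNormFDerivOfLeConst ℝ μ U p q * eLpNorm (fderiv ℝ φ) p (μ.restrict U) := by
  have hsupp : Function.support (fderiv ℝ φ) ⊆ U := (support_fderiv_subset ℝ).trans hφ.2.2
  have hnorm : eLpNorm (fderiv ℝ φ) p (μ.restrict U) = eLpNorm (fderiv ℝ φ) p μ := by
    rw [← eLpNorm_norm, ← eLpNorm_norm (fderiv ℝ φ)]
    exact eLpNorm_restrict_eq_of_support_subset fun x hx => hsupp (norm_ne_zero_iff.1 hx)
  rw [hnorm]
  exact (eLpNorm_mono_measure φ Measure.restrict_le_self).trans <|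
    eLpNorm_le_eLpNorm_fderiv_of_le μ (hφ.1.of_le (by simp))
      ((subset_tsupport φ).trans hφ.2.2) hp hpV hpq hU

/-- The Sobolev exponent `p` of `q`, given by `1 / p = 1 / q + 1 / dim V`, lies in `[1, 2]`;
Hölder's inequality on the bounded set `U` then raises it to `2`. -/
lemma exists_eLpNorm_le_eLpNorm_fderiv (hU : Bornology.IsBounded U) (hq : 0 < q)
    (hV : 0 < finrank ℝ V) (hle : q⁻¹ + (finrank ℝ V : ℝ≥0)⁻¹ ≤ 1)
    (hge : 2⁻¹ ≤ q⁻¹ + (finrank ℝ V : ℝ≥0)⁻¹) :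
    ∃ C : ℝ≥0, ∀ φ : V → ℝ, IsTest U φ →
      eLpNorm φ q (μ.restrict U) ≤ C * eLpNorm (fderiv ℝ φ) 2 (μ.restrict U) := by
  set n : ℝ≥0 := (finrank ℝ V : ℝ≥0) with hn
  have hn0 : 0 < n := Nat.cast_pos.2 hV
  obtain ⟨p, hp⟩ : ∃ p : ℝ≥0, p⁻¹ = q⁻¹ + n⁻¹ := ⟨_, inv_inv _⟩
  have hp0 : 0 < p := inv_pos.1 (hp ▸ by positivity)
  have hp1 : 1 ≤ p := (inv_le_one₀ hp0).1 (hp ▸ hle)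
  have hp2 : p ≤ 2 := (inv_le_inv₀ two_pos hp0).1 (hp ▸ hge)
  have hpn : p < n := (inv_lt_inv₀ hn0 hp0).1 (hp ▸ lt_add_of_pos_left _ (inv_pos.2 hq))
  have hpq : (p : ℝ)⁻¹ - (finrank ℝ V : ℝ)⁻¹ ≤ (q : ℝ)⁻¹ := by
    rw [← NNReal.coe_inv, hp, hn]
    simp
  set K := eLpNormLESNormFDerivOfLeConst ℝ μ U p q
  set m := μ U ^ (1 / (p : ℝ≥0∞).toReal - 1 / (2 : ℝ≥0∞).toReal)
  have hm : m ≠ ⊤ := by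
    refine ENNReal.rpow_ne_top_of_nonneg (sub_nonneg.2 ?_) hU.measure_lt_top.ne
    exact one_div_le_one_div_of_le hp0 (by exact_mod_cast hp2)
  refine ⟨K * m.toNNReal, fun φ hφ => ?_⟩
  have hholder := eLpNorm_le_eLpNorm_mul_rpow_measure_univ (μ := μ.restrict U) (p := p) (q := 2)
    (by exact_mod_cast hp2) (hφ.1.continuous_fderiv (by simp)).aestronglyMeasurable
  rw [Measure.restrict_apply_univ] at hholder
  calc eLpNorm φ q (μ.restrict U)
      ≤ K * eLpNorm (fderiv ℝ φ) p (μ.restrict U) :=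
        hφ.eLpNorm_le_eLpNorm_fderiv hU hp1 hpn hpq
    _ ≤ K * (eLpNorm (fderiv ℝ φ) 2 (μ.restrict U) * m) := by gcongr
    _ = _ := by rw [ENNReal.coe_mul, ENNReal.coe_toNNReal hm]; ring

end

variable {d : ℕ} {Ω : Set (Pt d)} {q : ℝ≥0}

lemma eLpNorm_val_le_of_test (hΩ : IsOpen Ω) {C : ℝ≥0}
    (hC : ∀ φ, IsTest Ω φ → eLpNorm φ q (vol Ω) ≤ C * eLpNorm (fderiv ℝ φ) 2 (vol Ω)) {v : H1 Ω}
    (hv : v ∈ H10 Ω) : eLpNorm (val v) q (vol Ω) ≤ C * ‖grad v‖ₑ := by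
  have htest : ∀ w ∈ testH1 Ω, eLpNorm (val w) q (vol Ω) ≤ C * ‖grad w‖ₑ := fun w hw => by
    obtain ⟨φ, hφ, rfl⟩ := exists_eq_toH1 hΩ hw
    rw [eLpNorm_congr_ae hφ.val_toH1, Lp.enorm_def, eLpNorm_congr_ae hφ.grad_toH1,
      eLpNorm_congr_norm_ae (.of_forall (norm_gradient φ))]
    exact hC φ hφ
  obtain ⟨w, hw, hlim⟩ := mem_closure_iff_seq_limit.1 hv
  have hval : Tendsto (fun k => val (w k)) atTop (𝓝 (val v)) :=
    ((valL Ω).continuous.tendsto v).comp hlim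
  obtain ⟨k, hk, hae⟩ := (tendstoInMeasure_of_tendsto_Lp hval).exists_seq_tendsto_ae
  have hgrad : Tendsto (fun j => C * ‖grad (w (k j))‖ₑ) atTop (𝓝 (C * ‖grad v‖ₑ)) :=
    ENNReal.Tendsto.const_mul
      (((gradL Ω).continuous.tendsto v).comp (hlim.comp hk.tendsto_atTop)).enorm
      (.inr ENNReal.coe_ne_top)
  calc eLpNorm (val v) q (vol Ω)
      ≤ liminf (fun j => eLpNorm (val (w (k j))) q (vol Ω)) atTop :=
        Lp.eLpNorm_lim_le_liminf_eLpNorm (fun j => Lp.aestronglyMeasurable _) _ hae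
    _ ≤ liminf (fun j => C * ‖grad (w (k j))‖ₑ) atTop :=
        liminf_le_liminf (.of_forall fun j => htest _ (hw _))
    _ = C * ‖grad v‖ₑ := hgrad.liminf_eq

/-- Sobolev's inequality in `H¹₀(Ω)`; it is Poincaré's inequality when `q = 2`. -/
theorem exists_eLpNorm_val_le (hΩ : IsOpen Ω) (hΩb : Bornology.IsBounded Ω) (hq : 0 < q)
    (hd : 0 < d) (hle : q⁻¹ + (d : ℝ≥0)⁻¹ ≤ 1) (hge : 2⁻¹ ≤ q⁻¹ + (d : ℝ≥0)⁻¹) :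
    ∃ C : ℝ≥0, ∀ v ∈ H10 Ω, eLpNorm (val v) q (vol Ω) ≤ C * ‖grad v‖ₑ := by
  rw [← finrank_euclideanSpace_fin (𝕜 := ℝ) (n := d)] at hd hle hge
  obtain ⟨C, hC⟩ := exists_eLpNorm_le_eLpNorm_fderiv (μ := volume) hΩb hq hd hle hge
  exact ⟨C, fun v hv => eLpNorm_val_le_of_test hΩ hC hv⟩

theorem exists_norm_val_le (hΩ : IsOpen Ω) (hΩb : Bornology.IsBounded Ω) (hd : 2 ≤ d) :
    ∃ C : ℝ≥0, ∀ v ∈ H10 Ω, ‖val v‖ ≤ C * ‖grad v‖ := by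
  have hinv : (d : ℝ≥0)⁻¹ ≤ 2⁻¹ := inv_anti₀ two_pos (by exact_mod_cast hd)
  obtain ⟨C, hC⟩ := exists_eLpNorm_val_le (q := 2) hΩ hΩb two_pos (by lia)
    ((add_le_add_right hinv _).trans_eq (by norm_num)) (le_add_of_nonneg_right zero_le)
  refine ⟨C, fun v hv => ?_⟩
  have h := ENNReal.toReal_mono (by finiteness) (hC v hv)
  rwa [ENNReal.toReal_mul, toReal_enorm] at h

theorem exists_eLpNorm_four_val_le (hΩ : IsOpen Ω) (hΩb : Bornology.IsBounded Ω) (hd : 2 ≤ d)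
    (hd' : d ≤ 4) : ∃ C : ℝ≥0, ∀ v ∈ H10 Ω, eLpNorm (val v) 4 (vol Ω) ≤ C * ‖grad v‖ₑ := by
  refine exists_eLpNorm_val_le (q := 4) hΩ hΩb four_pos (by lia) ?_ ?_ <;>
    interval_cases d <;>
    exact NNReal.coe_le_coe.1 (by norm_num)

end SobolevInequality

open ContinuousLinearMap (lsmul)

section LpSpaces

variable {α X E : Type*} {m : MeasurableSpace α} {μ : Measure α} [NormedAddCommGroup X]
  [NormedSpace ℝ X] [NormedAddCommGroup E] {p q : ℝ≥0∞} [Fact (1 ≤ p)] [Fact (1 ≤ q)]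

lemma exists_clm_coeFn_eq [NormedSpace ℝ E] (T : X →L[ℝ] Lp E p μ) {C : ℝ≥0}
    (h : ∀ x, eLpNorm (T x) q μ ≤ C * ‖x‖ₑ) : ∃ J : X →L[ℝ] Lp E q μ, ∀ x, J x =ᵐ[μ] T x := by
  have hmem : ∀ x, MemLp (T x) q μ := fun x =>
    ⟨Lp.aestronglyMeasurable _, (h x).trans_lt (by finiteness)⟩
  let J : X →ₗ[ℝ] Lp E q μ :=
    { toFun := fun x => (hmem x).toLp
      map_add' := fun x y => by
        rw [← MemLp.toLp_add]
        exact MemLp.toLp_congr _ _ (by rw [map_add]; exact Lp.coeFn_add _ _)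
      map_smul' := fun c x => by
        rw [RingHom.id_apply, ← MemLp.toLp_const_smul]
        exact MemLp.toLp_congr _ _ (by rw [map_smul]; exact Lp.coeFn_smul _ _) }
  refine ⟨J.mkContinuous C fun x => ?_, fun x => (hmem x).coeFn_toLp⟩
  have hle := ENNReal.toReal_mono (by finiteness) (h x)
  rw [ENNReal.toReal_mul, toReal_enorm] at hle
  exact (Lp.norm_toLp _ (hmem x)).trans_le hle

lemma coeFn_holderL {F G : Type*} [NormedSpace ℝ E] [NormedAddCommGroup F] [NormedSpace ℝ F]
    [NormedAddCommGroup G] [NormedSpace ℝ G] {r : ℝ≥0∞} [Fact (1 ≤ r)] [ENNReal.HolderTriple p q r]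
    (B : E →L[ℝ] F →L[ℝ] G) (f : Lp E p μ) (g : Lp F q μ) :
    B.holderL μ p q r f g =ᵐ[μ] fun x => B (f x) (g x) :=
  B.coeFn_holder f g

lemma mul_norm_sq_le_inner_holderL [InnerProductSpace ℝ E] {k : Lp ℝ ∞ μ} {c : ℝ}
    (hk : ∀ᵐ x ∂μ, c ≤ k x) (f : Lp E 2 μ) :
    c * ‖f‖ ^ 2 ≤ ⟪f, (lsmul ℝ ℝ).holderL μ ∞ 2 2 k f⟫ := by
  rw [← real_inner_self_eq_norm_sq, L2.inner_def, L2.inner_def, ← integral_const_mul]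
  refine integral_mono_ae ((L2.integrable_inner f f).const_mul c) (L2.integrable_inner _ _) ?_
  filter_upwards [hk, coeFn_holderL (r := 2) (lsmul ℝ ℝ) k f] with x hx heq
  rw [heq, ContinuousLinearMap.lsmul_apply, real_inner_smul_right]
  exact mul_le_mul_of_nonneg_right hx real_inner_self_nonneg

end LpSpaces

section FormOperator

variable {X M F : Type*} [NormedAddCommGroup X] [NormedSpace ℝ X] [NormedAddCommGroup M]
  [InnerProductSpace ℝ M] [CompleteSpace M] [NormedAddCommGroup F] [InnerProductSpace ℝ F]
  [CompleteSpace F]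

/-- The operator `X → M' ≅ M` representing the bilinear form `(x, w) ↦ ⟪P w, Q x⟫`. -/
noncomputable def formOperator (P : M →L[ℝ] F) (Q : X →L[ℝ] F) : X →L[ℝ] M := P† ∘L Q

lemma inner_formOperator (P : M →L[ℝ] F) (Q : X →L[ℝ] F) (w : M) (x : X) :
    ⟪w, formOperator P Q x⟫ = ⟪P w, Q x⟫ :=
  P.adjoint_inner_right w (Q x)

end FormOperator

section Diffusion

variable {d : ℕ} {Ω : Set (Pt d)} {φ : Pt d → ℝ}

/-- The operator `H¹(Ω) → H¹₀(Ω)' ≅ H¹₀(Ω)` of diffusion with coefficient `k`, sending `v` to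
`w ↦ ∫ k ∇v · ∇w`. -/
noncomputable def diffusion (k : Lp ℝ ∞ (vol Ω)) : H1 Ω →L[ℝ] H10 Ω :=
  formOperator (M := H10 Ω) (gradL Ω ∘L (H10 Ω).subtypeL)
    ((lsmul ℝ ℝ).holderL (vol Ω) ∞ 2 2 k ∘L gradL Ω)

lemma inner_diffusion (k : Lp ℝ ∞ (vol Ω)) (w : H10 Ω) (v : H1 Ω) :
    ⟪w, diffusion k v⟫ = ⟪grad (w : H1 Ω), (lsmul ℝ ℝ).holderL (vol Ω) ∞ 2 2 k (grad v)⟫ := by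
  rw [diffusion]
  exact inner_formOperator _ _ w v

lemma IsTest.inner_diffusion (hφ : IsTest Ω φ) {k : Lp ℝ ∞ (vol Ω)} {κ : Pt d → ℝ}
    (hk : k =ᵐ[vol Ω] κ) (v : H1 Ω) :
    ⟪hφ.toH10, diffusion k v⟫ = ∫ x in Ω, κ x * ∑ j, grad v x j * pd j φ x := by
  rw [CFD.inner_diffusion, real_inner_comm, hφ.coe_toH10,
    inner_lp_eq_integral (coeFn_holderL _ _ _) hφ.grad_toH1]
  refine integral_congr_ae ?_
  filter_upwards [hk] with x hx
  rw [ContinuousLinearMap.lsmul_apply, real_inner_smul_left, inner_gradient, hx]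

/-- Coercivity comes from Poincaré's inequality, `C` being its constant. -/
lemma mul_norm_sq_le_inner_diffusion {k : Lp ℝ ∞ (vol Ω)} {c : ℝ} (hc : 0 ≤ c)
    (hk : ∀ᵐ x ∂vol Ω, c ≤ k x) {C : ℝ≥0} (hC : ∀ v ∈ H10 Ω, ‖val v‖ ≤ C * ‖grad v‖) (w : H10 Ω) :
    c / (C ^ 2 + 1) * ‖w‖ ^ 2 ≤ ⟪w, diffusion k w⟫ := by
  have hval : ‖val (w : H1 Ω)‖ ^ 2 ≤ C ^ 2 * ‖grad (w : H1 Ω)‖ ^ 2 := by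
    rw [← mul_pow]
    gcongr
    exact hC w w.2
  have hnorm : ‖w‖ ^ 2 ≤ (C ^ 2 + 1) * ‖grad (w : H1 Ω)‖ ^ 2 := by
    rw [show ‖w‖ = ‖(w : H1 Ω)‖ from rfl, norm_sq_eq]
    linarith
  rw [inner_diffusion]
  refine le_trans ?_ (mul_norm_sq_le_inner_holderL hk _)
  rw [div_mul_eq_mul_div, div_le_iff₀ (by positivity), mul_right_comm, mul_assoc]
  exact mul_le_mul_of_nonneg_left hnorm hc

end Diffusion

section Advection

instance fact_one_le_four : Fact ((1 : ℝ≥0∞) ≤ 4) := ⟨by norm_num⟩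

instance holderTriple_four_four_two : ENNReal.HolderTriple 4 4 2 :=
  ⟨by
    rw [← ENNReal.toReal_eq_toReal_iff' (by simp) (by simp), ENNReal.toReal_add (by simp) (by simp)]
    norm_num⟩

variable {d : ℕ} {Ω : Set (Pt d)} {φ : Pt d → ℝ} {u : Vel Ω} {J : H10 Ω →L[ℝ] Lp ℝ 4 (vol Ω)}
  {U : Lp (Pt d) 4 (vol Ω)}

/-- A velocity in `H¹(Ω)^d`, as an `ℝ^d`-valued function. -/
noncomputable def velocityField (u : Vel Ω) (x : Pt d) : Pt d :=
  WithLp.toLp 2 fun j => val (u j) x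

lemma inner_velocityField_grad (u : Vel Ω) (v : H1 Ω) (x : Pt d) :
    ⟪velocityField u x, grad v x⟫ = advect u v x := by
  simp only [velocityField, PiLp.inner_apply, RCLike.inner_apply, conj_trivial, advect, mul_comm]

lemma memLp_four_of_sub_mem (hΩ : IsOpen Ω) (hΩb : Bornology.IsBounded Ω) (hd : 2 ≤ d)
    (hd' : d ≤ 4) {v b : H1 Ω} (h : v - b ∈ H10 Ω) (hb : MemLp (val b) 4 (vol Ω)) :
    MemLp (val v) 4 (vol Ω) := by
  obtain ⟨C, hC⟩ := exists_eLpNorm_four_val_le hΩ hΩb hd hd'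
  have hsub : MemLp (val (v - b)) 4 (vol Ω) :=
    ⟨Lp.aestronglyMeasurable _, (hC _ h).trans_lt (by finiteness)⟩
  refine (hsub.add hb).ae_eq ?_
  filter_upwards [Lp.coeFn_sub (val v) (val b)] with x hx
  rw [Pi.add_apply, ← valL_apply, map_sub, valL_apply, valL_apply, hx, Pi.sub_apply,
    sub_add_cancel]

lemma IsFlow.memLp_velocityField (hΩ : IsOpen Ω) (hΩb : Bornology.IsBounded Ω) (hd : 2 ≤ d)
    (hd' : d ≤ 4) {t₀ t₁ : ℝ} {D : Data Ω t₀ t₁} {p : Pres Ω} (hup : IsFlow D u p)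
    (hub : ∀ i, MemLp (val (D.ub i)) 4 (vol Ω)) : MemLp (velocityField u) 4 (vol Ω) :=
  .of_eval_piLp fun i => memLp_four_of_sub_mem hΩ hΩb hd hd' (hup.1 i) (hub i)

lemma exists_clm_coeFn_eq_val (hΩ : IsOpen Ω) (hΩb : Bornology.IsBounded Ω) (hd : 2 ≤ d)
    (hd' : d ≤ 4) :
    ∃ J : H10 Ω →L[ℝ] Lp ℝ 4 (vol Ω), ∀ w : H10 Ω, J w =ᵐ[vol Ω] val (w : H1 Ω) := by
  obtain ⟨C, hC⟩ := exists_eLpNorm_four_val_le hΩ hΩb hd hd'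
  have hle : ∀ w : H10 Ω, eLpNorm (val (w : H1 Ω)) 4 (vol Ω) ≤ C * ‖w‖ₑ := fun w =>
    (hC w w.2).trans (by gcongr; exact enorm_le_iff_norm_le.2 (norm_grad_le (w : H1 Ω)))
  exact @exists_clm_coeFn_eq (Pt d) (H10 Ω) ℝ _ (vol Ω) (H10 Ω).normedAddCommGroup
    (H10 Ω).normedSpace _ 2 4 _ _ _ (valL Ω ∘L (H10 Ω).subtypeL) C hle

/-- The operator `H¹(Ω) → H¹₀(Ω)' ≅ H¹₀(Ω)` of advection by the velocity `U`, sending `v` to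
`w ↦ ∫ (U · ∇v) w`. The Sobolev embedding `J` of `H¹₀(Ω)` into `L⁴(Ω)` makes the integral finite. -/
noncomputable def advection (J : H10 Ω →L[ℝ] Lp ℝ 4 (vol Ω)) (U : Lp (Pt d) 4 (vol Ω)) :
    H1 Ω →L[ℝ] H10 Ω :=
  formOperator (M := H10 Ω) ((lsmul ℝ ℝ).flip.holderL (vol Ω) 4 4 2 U ∘L J) (gradL Ω)

lemma inner_advection (w : H10 Ω) (v : H1 Ω) :
    ⟪w, advection J U v⟫ = ⟪(lsmul ℝ ℝ).flip.holderL (vol Ω) 4 4 2 U (J w), grad v⟫ := by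
  rw [advection]
  exact inner_formOperator _ _ w v

lemma IsTest.inner_advection (hφ : IsTest Ω φ) (hJ : ∀ w : H10 Ω, J w =ᵐ[vol Ω] val (w : H1 Ω))
    (hU : U =ᵐ[vol Ω] velocityField u) (v : H1 Ω) :
    ⟪hφ.toH10, advection J U v⟫ = ∫ x in Ω, advect u v x * φ x := by
  have hprod : (lsmul ℝ ℝ).flip.holderL (vol Ω) 4 4 2 U (J hφ.toH10)
      =ᵐ[vol Ω] fun x => φ x • velocityField u x := by
    filter_upwards [coeFn_holderL (r := 2) (lsmul ℝ ℝ).flip U (J hφ.toH10), hU, hJ hφ.toH10,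
      hφ.val_toH1] with x hmul hUx hJx hφx
    rw [hmul, hUx, hJx, ContinuousLinearMap.flip_apply, ContinuousLinearMap.lsmul_apply,
      hφ.coe_toH10, hφx]
  rw [CFD.inner_advection, inner_lp_eq_integral hprod .rfl]
  simp only [real_inner_smul_left, inner_velocityField_grad, mul_comm (φ _)]

lemma IsTest.integral_sum_val_mul_pd (hdiv : ∀ᵐ x ∂vol Ω, ∑ i, grad (u i) x i = 0)
    (hφ : IsTest Ω φ) : ∫ x in Ω, ∑ j, val (u j) x * pd j φ x = 0 := by
  calc ∫ x in Ω, ∑ j, val (u j) x * pd j φ x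
      = ∑ j, ∫ x in Ω, val (u j) x * pd j φ x :=
        integral_finsetSum _ fun j _ => (Lp.memLp (val (u j))).integrable_mul (hφ.memLp_pd j)
    _ = ∑ j, -∫ x in Ω, grad (u j) x j * φ x := Finset.sum_congr rfl fun j _ => (u j).2 j φ hφ
    _ = -∫ x in Ω, ∑ j, grad (u j) x j * φ x := by
        rw [Finset.sum_neg_distrib]
        exact congrArg Neg.neg (integral_finsetSum _ fun j _ =>
          (memLp_coord (grad (u j)) j).integrable_mul hφ.memLp).symm
    _ = 0 := by
        refine neg_eq_zero.2 (integral_eq_zero_of_ae ?_)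
        filter_upwards [hdiv] with x hx
        rw [← Finset.sum_mul, hx, zero_mul, Pi.zero_apply]

/-- `2 (u · ∇φ) φ = u · ∇(φ²)`, and `u` is divergence free. -/
lemma IsTest.integral_advect_mul_self (hdiv : ∀ᵐ x ∂vol Ω, ∑ i, grad (u i) x i = 0)
    (hφ : IsTest Ω φ) : ∫ x in Ω, advect u hφ.toH1 x * φ x = 0 := by
  have hsq := (hφ.mul hφ).integral_sum_val_mul_pd hdiv
  have hae : ∀ᵐ x ∂vol Ω,
      ∑ j, val (u j) x * pd j (fun x => φ x * φ x) x = 2 * (advect u hφ.toH1 x * φ x) := by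
    filter_upwards [hφ.grad_toH1] with x hx
    simp only [advect, hx, gradient_apply_eq_pd, hφ.pd_mul hφ, Finset.sum_mul, Finset.mul_sum]
    exact Finset.sum_congr rfl fun j _ => by ring
  rw [integral_congr_ae hae, integral_const_mul] at hsq
  exact (mul_eq_zero.1 hsq).resolve_left two_ne_zero

lemma inner_advection_self (hΩ : IsOpen Ω) (hJ : ∀ w : H10 Ω, J w =ᵐ[vol Ω] val (w : H1 Ω))
    (hU : U =ᵐ[vol Ω] velocityField u) (hdiv : ∀ᵐ x ∂vol Ω, ∑ i, grad (u i) x i = 0)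
    (w : H10 Ω) : ⟪w, advection J U w⟫ = 0 := by
  have hcont : Continuous fun w : H10 Ω => ⟪w, advection J U w⟫ :=
    continuous_id.inner ((advection J U).continuous.comp continuous_subtype_val)
  refine congrFun (hcont.ext_on (dense_toH10 hΩ) continuous_const ?_) w
  rintro _ ⟨φ, hφ, rfl⟩
  exact (hφ.inner_advection hJ hU _).trans (hφ.integral_advect_mul_self hdiv)

end Advection

section Temperature

variable {d : ℕ} {Ω : Set (Pt d)} {t₀ t₁ : ℝ} {κ : Pt d → ℝ} {u : Vel Ω}
  {g g' : Lp (Lp ℝ 2 (vol Ω)) 2 (tvol t₀ t₁)} {Tb Tb' T T' : Temp Ω t₀ t₁} {π π' : H1 Ω}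

variable {k : Lp ℝ ∞ (vol Ω)} {J : H10 Ω →L[ℝ] Lp ℝ 4 (vol Ω)} {U : Lp (Pt d) 4 (vol Ω)}

lemma IsTest.inner_valL {φ : Pt d → ℝ} (hφ : IsTest Ω φ) (z : Lp ℝ 2 (vol Ω)) :
    ⟪valL Ω hφ.toH10, z⟫ = ∫ x in Ω, z x * φ x :=
  (real_inner_comm _ _).trans (inner_lp_eq_integral_mul .rfl hφ.val_toH1)

lemma isTemperature_iff_isWeakSolution (hΩ : IsOpen Ω) (hk : k =ᵐ[vol Ω] κ)
    (hJ : ∀ w : H10 Ω, J w =ᵐ[vol Ω] val (w : H1 Ω)) (hU : U =ᵐ[vol Ω] velocityField u) :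
    IsTemperature κ u g Tb π T ↔
      IsWeakSolution (valL Ω) (diffusion k + advection J U) g Tb (val π) T := by
  have hsplit : ∀ {φ ψ} (hφ : IsTest Ω φ), IsTest (Iio t₁) ψ →
      ∫ t in Ioo t₀ t₁, ψ t * ((∫ x in Ω, g t x * φ x)
          - ⟪hφ.toH10, (diffusion k + advection J U) (T t)⟫) =
        (∫ t in Ioo t₀ t₁, ψ t * ∫ x in Ω, g t x * φ x)
          - (∫ t in Ioo t₀ t₁, ψ t * ∫ x in Ω, κ x * ∑ j, grad (T t) x j * pd j φ x)
          - ∫ t in Ioo t₀ t₁, ψ t * ∫ x in Ω, advect u (T t) x * φ x := fun {φ ψ} hφ hψ => by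
    simpa only [hφ.inner_valL, hφ.inner_diffusion hk, hφ.inner_advection hJ hU] using
      integral_mul_inner_sub_inner_add hψ.1.continuous (valL Ω hφ.toH10) g hφ.toH10 (diffusion k)
        (advection J U) T
  rw [isWeakSolution_iff_inner (dense_toH10 hΩ)]
  refine and_congr_right fun _ => ⟨?_, fun h φ ψ hφ hψ => ?_⟩
  · rintro h _ ⟨φ, hφ, rfl⟩ ψ hψ
    simp only [smul_eq_mul, hφ.inner_valL, hsplit hφ hψ]
    simp only [valL_apply]
    linarith [h φ ψ hφ hψ]
  · have hweak := h _ ⟨φ, hφ, rfl⟩ ψ hψ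
    simp only [smul_eq_mul, hφ.inner_valL, hsplit hφ hψ] at hweak
    simp only [valL_apply] at hweak
    linarith

lemma IsTemperature.add_smul_of_homogeneous (hΩ : IsOpen Ω) (hΩb : Bornology.IsBounded Ω)
    (hd : 2 ≤ d) (hd' : d ≤ 4) (hκ : MemLp κ ∞ (vol Ω)) (hu : MemLp (velocityField u) 4 (vol Ω))
    (hT : IsTemperature κ u g Tb π T) (hT' : IsTemperature κ u 0 0 π' T') (s : ℝ) :
    IsTemperature κ u g Tb (π + s • π') (T + s • T') := by
  obtain ⟨J, hJ⟩ := exists_clm_coeFn_eq_val hΩ hΩb hd hd'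
  rw [isTemperature_iff_isWeakSolution hΩ hκ.coeFn_toLp hJ hu.coeFn_toLp] at hT hT' ⊢
  exact hT.add_smul_of_homogeneous hT' s

lemma mul_norm_sq_le_inner_diffusion_add_advection (hΩ : IsOpen Ω) {c : ℝ} (hc : 0 ≤ c)
    (hk : ∀ᵐ x ∂vol Ω, c ≤ k x) {C : ℝ≥0} (hC : ∀ v ∈ H10 Ω, ‖val v‖ ≤ C * ‖grad v‖)
    (hJ : ∀ w : H10 Ω, J w =ᵐ[vol Ω] val (w : H1 Ω)) (hU : U =ᵐ[vol Ω] velocityField u)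
    (hdiv : ∀ᵐ x ∂vol Ω, ∑ i, grad (u i) x i = 0) (w : H10 Ω) :
    c / (C ^ 2 + 1) * ‖w‖ ^ 2 ≤ ⟪(diffusion k + advection J U) (w : H1 Ω), w⟫ :=
  calc c / (C ^ 2 + 1) * ‖w‖ ^ 2
      ≤ ⟪w, diffusion k w⟫ := mul_norm_sq_le_inner_diffusion hc hk hC w
    _ = ⟪w, diffusion k w⟫ + ⟪w, advection J U w⟫ := by
        rw [inner_advection_self hΩ hJ hU hdiv w, add_zero]
    _ = ⟪w, diffusion k w + advection J U w⟫ := (inner_add_right w _ _).symm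
    _ = ⟪(diffusion k + advection J U) (w : H1 Ω), w⟫ := real_inner_comm _ _

theorem existsUnique_isTemperature (ht : t₀ < t₁) (hΩ : IsOpen Ω) (hΩb : Bornology.IsBounded Ω)
    (hd : 2 ≤ d) (hd' : d ≤ 4) (hκ : MemLp κ ∞ (vol Ω)) {c : ℝ} (hc : 0 < c)
    (hκc : ∀ᵐ x ∂vol Ω, c ≤ κ x) (hu : MemLp (velocityField u) 4 (vol Ω))
    (hdiv : ∀ᵐ x ∂vol Ω, ∑ i, grad (u i) x i = 0) (g : Lp (Lp ℝ 2 (vol Ω)) 2 (tvol t₀ t₁))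
    {G : Lp (Lp ℝ 2 (vol Ω)) 2 (tvol t₀ t₁)} (hTb : IsWeakTimeDeriv Tb G) (π : H1 Ω) :
    ∃! T, IsTemperature κ u g Tb π T := by
  obtain ⟨J, hJ⟩ := exists_clm_coeFn_eq_val hΩ hΩb hd hd'
  obtain ⟨C, hC⟩ := exists_norm_val_le hΩ hΩb hd
  have hk := hκ.coeFn_toLp
  have hU := hu.coeFn_toLp
  have hkc : ∀ᵐ x ∂vol Ω, c ≤ hκ.toLp κ x := by
    filter_upwards [hk, hκc] with x hx hcx
    rwa [hx]
  have hcoercive := mul_norm_sq_le_inner_diffusion_add_advection hΩ hc.le hkc hC hJ hU hdiv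
  exact (existsUnique_congr fun T => isTemperature_iff_isWeakSolution hΩ hk hJ hU).2
    (existsUnique_isWeakSolution ht (by positivity) hcoercive (valL_injective hΩ).injOn g hTb
      (val π))

lemma isWeakTimeDeriv_zero : IsWeakTimeDeriv (0 : Temp Ω t₀ t₁) 0 := by
  intro ψ _
  rw [integral_eq_zero_of_ae, integral_eq_zero_of_ae, neg_zero]
  · filter_upwards [Lp.coeFn_zero (Lp ℝ 2 (vol Ω)) 2 (tvol t₀ t₁)] with t ht
    simp only [ht, Pi.zero_apply, smul_zero]
  · filter_upwards [Lp.coeFn_zero (H1 Ω) 2 (tvol t₀ t₁)] with t ht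
    simp only [ht, Pi.zero_apply, ← valL_apply, map_zero, smul_zero]

end Temperature

lemma hasLineDerivAt_prodMk_const {X E F : Type*} [AddCommGroup X] [Module ℝ X]
    [NormedAddCommGroup E] [NormedSpace ℝ E] [NormedAddCommGroup F] [NormedSpace ℝ F] {f : X → E}
    {w : E} {x v : X} (h : ∀ s : ℝ, f (x + s • v) = f x + s • w) (y : F) :
    HasLineDerivAt ℝ (fun x => (f x, y)) (w, 0) x v := by
  have hf : HasDerivAt (fun s : ℝ => f (x + s • v)) w 0 := by
    simp only [h]
    simpa using ((hasDerivAt_id (0 : ℝ)).smul_const w).const_add (f x)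
  exact hf.prodMk (hasDerivAt_const _ _)

end CFD

theorem mainTheorem4_general {d : ℕ} (hd : 2 ≤ d) (hd' : d ≤ 4) (Ω : Set (CFD.Pt d))
    (hΩo : IsOpen Ω) (hΩb : Bornology.IsBounded Ω) (hΩc : IsConnected Ω) (t₀ t₁ : ℝ) (ht : t₀ < t₁)
    (D : CFD.Data Ω t₀ t₁) (hD : D.Admissible)
    (u : CFD.Vel Ω) (p : CFD.Pres Ω) (hup : CFD.IsFlow D u p) :
    ∃ S : CFD.H1 Ω → CFD.State Ω t₀ t₁,
      (∀ (π : CFD.H1 Ω) (z : CFD.State Ω t₀ t₁),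
        (CFD.IsCFDSolution D π z ∧ z.2.1 = u) ↔ z = S π) ∧
      ((∀ (u' : CFD.Vel Ω) (p' : CFD.Pres Ω), CFD.IsFlow D u' p' → u' = u) →
        ∀ (π : CFD.H1 Ω) (z : CFD.State Ω t₀ t₁), CFD.IsCFDSolution D π z ↔ z = S π) ∧
      ∀ π₀ δπ₀ : CFD.H1 Ω, ∃ w : CFD.Temp Ω t₀ t₁,
        (∀ w' : CFD.Temp Ω t₀ t₁,
          CFD.IsTemperature D.κ (S π₀).2.1 0 0 δπ₀ w' ↔ w' = w) ∧
        HasLineDerivAt ℝ S (w, 0, 0) π₀ δπ₀ := by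
  obtain ⟨c, hc, hκc⟩ := hD.κ_pos
  obtain ⟨G, hG⟩ := hD.Tb_deriv
  have hu := hup.memLp_velocityField hΩo hΩb hd hd' hD.ub_L4
  choose T hT hTu using
    CFD.existsUnique_isTemperature ht hΩo hΩb hd hd' hD.κ_bdd hc hκc hu hup.2.1 D.gT hG
  choose W hW hWu using CFD.existsUnique_isTemperature ht hΩo hΩb hd hd' hD.κ_bdd hc hκc hu
    hup.2.1 0 CFD.isWeakTimeDeriv_zero
  have hS : ∀ (π : CFD.H1 Ω) (z : CFD.State Ω t₀ t₁),
      (CFD.IsCFDSolution D π z ∧ z.2.1 = u) ↔ z = (T π, u, p) := by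
    rintro π ⟨T', u', p'⟩
    constructor
    · rintro ⟨⟨hflow, htemp⟩, rfl⟩
      rw [hTu π T' htemp, show p' = p from hflow.pressure_unique hΩo hΩb hΩc hup]
    · rintro ⟨⟩
      exact ⟨⟨hup, hT π⟩, rfl⟩
  have hTW : ∀ π δ (s : ℝ), T (π + s • δ) = T π + s • W δ := fun π δ s =>
    (hTu _ _ ((hT π).add_smul_of_homogeneous hΩo hΩb hd hd' hD.κ_bdd hu (hW δ) s)).symm
  refine ⟨fun π => (T π, u, p), hS, fun hu π z => ?_, fun π₀ δ => ⟨W δ, fun w' => ?_, ?_⟩⟩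
  · exact ⟨fun h => (hS π z).1 ⟨h, hu _ _ h.1⟩, fun h => ((hS π z).2 h).1⟩
  · exact ⟨hWu δ w', fun h => h ▸ hW δ⟩
  · exact CFD.hasLineDerivAt_prodMk_const (hTW π₀ δ) (u, p)

theorem mainTheorem4 {d : ℕ} (hd : d = 2 ∨ d = 3) (Ω : Set (CFD.Pt d)) (hΩo : IsOpen Ω)
    (hΩb : Bornology.IsBounded Ω) (hΩc : IsConnected Ω) (t₀ t₁ : ℝ) (ht : t₀ < t₁)
    (D : CFD.Data Ω t₀ t₁) (hD : D.Admissible)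
    (u : CFD.Vel Ω) (p : CFD.Pres Ω) (hup : CFD.IsFlow D u p) :
    ∃ S : CFD.H1 Ω → CFD.State Ω t₀ t₁,
      (∀ (π : CFD.H1 Ω) (z : CFD.State Ω t₀ t₁),
        (CFD.IsCFDSolution D π z ∧ z.2.1 = u) ↔ z = S π) ∧
      ((∀ (u' : CFD.Vel Ω) (p' : CFD.Pres Ω), CFD.IsFlow D u' p' → u' = u) →
        ∀ (π : CFD.H1 Ω) (z : CFD.State Ω t₀ t₁), CFD.IsCFDSolution D π z ↔ z = S π) ∧
      ∀ π₀ δπ₀ : CFD.H1 Ω, ∃ w : CFD.Temp Ω t₀ t₁,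
        (∀ w' : CFD.Temp Ω t₀ t₁,
          CFD.IsTemperature D.κ (S π₀).2.1 0 0 δπ₀ w' ↔ w' = w) ∧
        HasLineDerivAt ℝ S (w, 0, 0) π₀ δπ₀ :=
  mainTheorem4_general (by omega) (by omega) Ω hΩo hΩb hΩc t₀ t₁ ht D hD u p hup
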